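/- Let $\rho=\frac12+\frac{\sqrt3}{2}i$, and for points $x,y$ of $\mathbb{H}\cup\mathbb{Q}\cup\{\infty\}$ let $H_{x,y}$ be the hyperbolic geodesic arc joining them. An even edge (resp. odd edge) is an image under an element of $\mathrm{PSL}_2(\mathbb{Z})$ of $H_{i,\infty}$ (resp. of $H_{\rho,\infty}$). A special polygon $P$ (with a vertex at $\infty$) is a convex hyperbolic polygon with non-empty interior whose ideal vertices are $\infty$ and rational numbers $x_0<x_1<\dots<x_n$ ($n\ge 0$), together with a side pairing, as follows. Put $x_{-1}=x_{n+1}=\infty$. For each $0\le k\le n+1$ there is $\gamma_k\in \mathrm{PSL}_2(\mathbb{Z})$ with $\gamma_k(0)=x_{k-1}$ and $\gamma_k(\infty)=x_k$, and between $x_{k-1}$ and $x_k$ the polygon carries one of three kinds of pairing. * Even pairing: the boundary of $P$ from $x_{k-1}$ to $x_k$ consists of the two even edges $\gamma_k H_{0,i}$ and $\gamma_k H_{i,\infty}$. These are two sides, and they are paired with each other. * Odd pairing: the boundary of $P$ from $x_{k-1}$ to $x_k$ consists of the two odd edges $\gamma_k H_{0,\rho}$ and $\gamma_k H_{\rho,\infty}$,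 which meet at an interior angle of $2\pi/3$. These are two sides, and they are paired with each other. * Free pairing: the boundary of $P$ from $x_{k-1}$ to $x_k$ is the single side $\gamma_k H_{0,\infty}$. The free sides are partitioned into pairs. The sides are oriented by tracing the boundary of $P$. Let $\Gamma=\Gamma_P\le \mathrm{PSL}_2(\mathbb{Z})$ be the group generated by the side pairing transformations, that is, by the elements of $\mathrm{PSL}_2(\mathbb{Z})$ that map a side to its paired side in an orientation-reversing manner. For $0\le i\le n$ write $x_i=a_i/b_i$ in lowest terms with $b_i>0$, and put $(a_{-1},b_{-1})=(-1,0)$ and $(a_{n+1},b_{n+1})=(1,0)$. Then $a_{i+1}b_i-a_ib_{i+1}=1$ for $-1\le i\le n$. Let $$T=\begin{pmatrix}1&1\\0&1\end{pmatrix},\qquad \varphi_i=\begin{pmatrix}a_i&-a_{i+1}\\ b_i&-b_{i+1}\end{pmatrix}\qquad(-1\le i\le n),$$ so that $\varphi_i\in \mathrm{PSL}_2(\mathbb{Z})$, $\varphi_i^{-1}(x_i)=\infty$ and $\varphi_i^{-1}(x_{i+1})=0$. Indices being cyclic (the vertex preceding $x_{-1}=\infty$ is $x_n$, so for $i=-1$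 read $x_{i-1}$, $a_{i-1}$, $b_{i-1}$ as $x_n$, $a_n$, $b_n$), let $$w_i=\begin{cases}|a_{i-1}b_{i+1}-a_{i+1}b_{i-1}|+1&\text{if the pairing between } x_{i-1}\text{ and }x_i\text{ is odd},\\ |a_{i-1}b_{i+1}-a_{i+1}b_{i-1}|&\text{otherwise.}\end{cases}$$ Then $$\bigcup_{i=-1}^{n}\{\,T^{-j}\varphi_i^{-1} : 0\le j<w_i\,\}$$ is a complete set of representatives of the left cosets $\alpha\Gamma$ of $\Gamma$ in $\mathrm{PSL}_2(\mathbb{Z})$: every left coset contains exactly one element of this set. -/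

import Mathlib

open scoped MatrixGroups OnePoint

noncomputable section

/-- A point of `ℍ ∪ ℚ ∪ {∞}`. -/
inductive ExtPoint where
  | inner (z : UpperHalfPlane)
  | ideal (c : OnePoint ℚ)

/-- The action of `SL(2, ℤ)` by Möbius transformations on `ℚ ∪ {∞}`. -/
def cuspMove (g : SL(2, ℤ)) (c : OnePoint ℚ) : OnePoint ℚ :=
  Matrix.SpecialLinearGroup.mapGL ℚ g • c

/-- The action of `SL(2, ℤ)` by Möbius transformations on `ℍ ∪ ℚ ∪ {∞}`. -/
def ExtPoint.move (g : SL(2, ℤ)) : ExtPoint → ExtPoint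
  | .inner z => .inner (g • z)
  | .ideal c => .ideal (cuspMove g c)

/-- The point `ρ = 1/2 + (√3/2) i`. -/
def rhoPoint : UpperHalfPlane := ⟨⟨1 / 2, Real.sqrt 3 / 2⟩, by positivity⟩

/-- The three kinds of pairing that a pair of consecutive ideal vertices of a special polygon can
carry. -/
inductive PairingKind where
  | even
  | odd
  | free

/-- The sequence `x₋₁ = ∞, x₀, …, xₙ, xₙ₊₁ = ∞`; position `k` holds `xₖ₋₁`. -/
def cuspSeq {n : ℕ} (x : Fin (n + 1) → ℚ) : Fin (n + 3) → OnePoint ℚ :=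
  Fin.cons ∞ (Fin.snoc (α := fun _ => OnePoint ℚ) (fun i => (x i : OnePoint ℚ)) ∞)

/-- Numerators `a₋₁ = -1, a₀, …, aₙ, aₙ₊₁ = 1`; position `k` holds `aₖ₋₁`. -/
def numSeq {n : ℕ} (x : Fin (n + 1) → ℚ) : Fin (n + 3) → ℤ :=
  Fin.cons (-1) (Fin.snoc (α := fun _ => ℤ) (fun i => (x i).num) 1)

/-- Denominators `b₋₁ = 0, b₀, …, bₙ, bₙ₊₁ = 0`; position `k` holds `bₖ₋₁`. -/
def denSeq {n : ℕ} (x : Fin (n + 1) → ℚ) : Fin (n + 3) → ℤ :=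
  Fin.cons 0 (Fin.snoc (α := fun _ => ℤ) (fun i => ((x i).den : ℤ)) 0)

/-- For `γ = 1`, the part of `ℍ` on the left of the boundary piece that runs from `0` to `∞`.
The piece is the imaginary axis (two even edges meeting at `i`) for an even or free pairing, and
`H_{0,ρ} ∪ H_{ρ,∞}` (two odd edges meeting at `ρ`, at an angle of `2π/3` on the left) for an odd
pairing; in the latter case the part on the left is the intersection of the two half-planes that
are bounded by the geodesics through `0, ρ` and `ρ, ∞`. For general `γ` everything is moved
by `γ`. -/
def leftPart (p : PairingKind) (γ : SL(2, ℤ)) : Set UpperHalfPlane :=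
  match p with
  | .odd => {z | (γ⁻¹ • z).re ≤ 1 / 2 ∧ 1 ≤ ‖((γ⁻¹ • z : UpperHalfPlane) : ℂ) - 1‖}
  | _ => {z | (γ⁻¹ • z).re ≤ 0}

/-- A special polygon with an ideal vertex at `∞`: a convex hyperbolic polygon bounded by even
and odd edges, with its side pairing. Its ideal vertices are `∞` and rational numbers
`x₀ < ⋯ < xₙ`. Consecutive ideal vertices `xₖ₋₁, xₖ` (`k = 0, …, n + 1`,
with `x₋₁ = xₙ₊₁ = ∞`) are joined by
* the image under `frame k` of the imaginary axis, made of the even edges `(frame k) H_{0,i}` and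
  `(frame k) H_{i,∞}`, for an even or free pairing;
* the images under `frame k` of `H_{0,ρ}` and `H_{ρ,∞}`, which are odd edges, for an odd pairing.
Here `frame k` is the element of `PSL(2, ℤ)` (given through a matrix) that takes `0` to `xₖ₋₁`
and `∞` to `xₖ`. The boundary is run through with the polygon on its left. -/
structure SpecialPolygon where
  n : ℕ
  x : Fin (n + 1) → ℚ
  strictMono_x : StrictMono x
  kind : Fin (n + 2) → PairingKind
  frame : Fin (n + 2) → SL(2, ℤ)
  frame_zero : ∀ k, cuspMove (frame k) ((0 : ℚ) : OnePoint ℚ) = cuspSeq x k.castSucc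
  frame_infty : ∀ k, cuspMove (frame k) ∞ = cuspSeq x k.succ
  /-- The region `⋂ k, leftPart (kind k) (frame k)` is a genuine polygon, not just an arc. -/
  interior_nonempty : (interior (⋂ k, leftPart (kind k) (frame k))).Nonempty
  /-- The partition of the free sides into sets of two. -/
  partner : Fin (n + 2) → Fin (n + 2)
  partner_partner : ∀ k, partner (partner k) = k
  partner_eq_self_iff : ∀ k, partner k = k ↔ kind k ≠ .free

/-- An oriented hyperbolic arc, given by its initial and its terminal point (which determine it).
An element of `SL(2, ℤ)` takes an arc to the arc between the images of the end points. -/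
structure OrientedArc where
  source : ExtPoint
  target : ExtPoint

/-- `γ` maps the arc `s` onto the arc `t` and reverses the orientation. -/
def MapsReversing (γ : SL(2, ℤ)) (s t : OrientedArc) : Prop :=
  s.source.move γ = t.target ∧ s.target.move γ = t.source

lemma cuspMove_infty (g : SL(2, ℤ)) :
    cuspMove g ∞ = if g 1 0 = 0 then ∞ else (((g 0 0 : ℚ) / (g 1 0 : ℚ) : ℚ) : OnePoint ℚ) := by
  simp [cuspMove, OnePoint.smul_infty_eq_ite]
lemma cuspMove_zero (g : SL(2, ℤ)) :
    cuspMove g ((0 : ℚ) : OnePoint ℚ) =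
      if g 1 1 = 0 then ∞ else (((g 0 1 : ℚ) / (g 1 1 : ℚ) : ℚ) : OnePoint ℚ) := by
  simp [cuspMove, OnePoint.smul_some_eq_ite]

lemma exists_sign {p q : ℤ} (h : IsCoprime p q) (hq : q ≠ 0) :
    ∃ e : ℤ, e * e = 1 ∧ ((p : ℚ) / q).num = e * p ∧ ((((p : ℚ) / q).den : ℕ) : ℤ) = e * q := by
  rcases lt_or_gt_of_ne hq with hq | hq
  · refine ⟨-1, by norm_num, ?_, ?_⟩
    · have := Rat.num_div_eq_of_coprime (a := -p) (b := -q) (by omega)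
        (by simpa [Int.gcd, Nat.Coprime] using Int.isCoprime_iff_gcd_eq_one.1 h)
      simpa using this
    · have := Rat.den_div_eq_of_coprime (a := -p) (b := -q) (by omega)
        (by simpa [Int.gcd, Nat.Coprime] using Int.isCoprime_iff_gcd_eq_one.1 h)
      simpa using this
  · refine ⟨1, by norm_num, ?_, ?_⟩
    · have := Rat.num_div_eq_of_coprime (a := p) (b := q) hq
        (by simpa [Int.gcd, Nat.Coprime] using Int.isCoprime_iff_gcd_eq_one.1 h)
      simpa using this
    · have := Rat.den_div_eq_of_coprime (a := p) (b := q) hq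
        (by simpa [Int.gcd, Nat.Coprime] using Int.isCoprime_iff_gcd_eq_one.1 h)
      simpa using this


/-- Consecutive ideal vertices in lowest terms satisfy `aₖ bₖ₋₁ - aₖ₋₁ bₖ = 1`. -/
lemma farey_relation {n : ℕ} {x : Fin (n + 1) → ℚ} (hx : StrictMono x) (k : Fin (n + 2))
    (g : SL(2, ℤ)) (h0 : cuspMove g ((0 : ℚ) : OnePoint ℚ) = cuspSeq x k.castSucc)
    (h1 : cuspMove g ∞ = cuspSeq x k.succ) :
    numSeq x k.succ * denSeq x k.castSucc - numSeq x k.castSucc * denSeq x k.succ = 1 := by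
  have hdet : g 0 0 * g 1 1 - g 0 1 * g 1 0 = 1 := by
    have := g.det_coe
    rwa [Matrix.det_fin_two] at this
  have c1 : IsCoprime (g 0 0) (g 1 0) := ⟨g 1 1, - g 0 1, by linarith⟩
  have c0 : IsCoprime (g 0 1) (g 1 1) := ⟨- g 1 0, g 0 0, by linarith⟩
  have s0 : (cuspSeq x k.castSucc = ∞ ∧ numSeq x k.castSucc = -1 ∧ denSeq x k.castSucc = 0 ∧ k = 0) ∨
      ∃ i : Fin (n + 1), k = i.succ ∧ cuspSeq x k.castSucc = (x i : OnePoint ℚ) ∧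
        numSeq x k.castSucc = (x i).num ∧ denSeq x k.castSucc = ((x i).den : ℤ) := by
    refine Fin.cases (Or.inl ?_) (fun i => Or.inr ⟨i, rfl, ?_⟩) k
    · simp [cuspSeq, numSeq, denSeq]
    · rw [← Fin.succ_castSucc]
      simp [cuspSeq, numSeq, denSeq]
  have s1 : (cuspSeq x k.succ = ∞ ∧ numSeq x k.succ = 1 ∧ denSeq x k.succ = 0 ∧ k = Fin.last _) ∨
      ∃ i : Fin (n + 1), k = i.castSucc ∧ cuspSeq x k.succ = (x i : OnePoint ℚ) ∧
        numSeq x k.succ = (x i).num ∧ denSeq x k.succ = ((x i).den : ℤ) := by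
    refine Fin.lastCases (Or.inl ?_) (fun i => Or.inr ⟨i, rfl, ?_⟩) k
    · simp [cuspSeq, numSeq, denSeq]
    · simp [cuspSeq, numSeq, denSeq]
  rw [cuspMove_zero] at h0
  rw [cuspMove_infty] at h1
  rcases s0 with ⟨e0, a0, b0, k0⟩ | ⟨i, k0, e0, a0, b0⟩ <;>
    rcases s1 with ⟨e1, a1, b1, k1⟩ | ⟨j, k1, e1, a1, b1⟩ <;>
    rw [e0] at h0 <;> rw [e1] at h1 <;> rw [a0, b0, a1, b1]
  · exfalso; rw [k0] at k1; simp [Fin.ext_iff] at k1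
  · have d0 : g 1 1 = 0 := by by_contra h; simp [h] at h0
    rw [d0] at hdet
    have d1 : g 1 0 ≠ 0 := by rintro h; simp [h] at hdet
    rw [if_neg d1, OnePoint.coe_eq_coe] at h1
    obtain ⟨e, he, hn, hd⟩ := exists_sign c1 d1
    rw [h1] at hn hd
    have hu : g 1 0 = 1 ∨ g 1 0 = -1 := Int.isUnit_iff.1 (IsUnit.of_mul_eq_one (- g 0 1) (by linarith))
    have he' : e = 1 ∨ e = -1 := Int.isUnit_iff.1 (IsUnit.of_mul_eq_one e he)
    have := (x j).den_pos
    rcases hu with h | h <;> rcases he' with h' | h' <;> rw [h, h'] at hd <;> omega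
  · have d0 : g 1 0 = 0 := by by_contra h; simp [h] at h1
    rw [d0] at hdet
    have d1 : g 1 1 ≠ 0 := by rintro h; simp [h] at hdet
    rw [if_neg d1, OnePoint.coe_eq_coe] at h0
    obtain ⟨e, he, hn, hd⟩ := exists_sign c0 d1
    rw [h0] at hn hd
    have hu : g 1 1 = 1 ∨ g 1 1 = -1 := Int.isUnit_iff.1 (IsUnit.of_mul_eq_one (g 0 0) (by linarith))
    have he' : e = 1 ∨ e = -1 := Int.isUnit_iff.1 (IsUnit.of_mul_eq_one e he)
    have := (x i).den_pos
    rcases hu with h | h <;> rcases he' with h' | h' <;> rw [h, h'] at hd <;> omega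
  · have d0 : g 1 1 ≠ 0 := by rintro h; simp [h] at h0
    have d1 : g 1 0 ≠ 0 := by rintro h; simp [h] at h1
    rw [if_neg d0, OnePoint.coe_eq_coe] at h0
    rw [if_neg d1, OnePoint.coe_eq_coe] at h1
    obtain ⟨e, he, hn, hd⟩ := exists_sign c0 d0
    obtain ⟨f, hf, hn', hd'⟩ := exists_sign c1 d1
    rw [h0] at hn hd
    rw [h1] at hn' hd'
    have hij : x i < x j := by
      apply hx
      rw [k0] at k1
      have := congrArg Fin.val k1
      simp at this
      exact Fin.lt_def.2 (by omega)
    rw [Rat.lt_iff] at hij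
    rw [hn, hd, hn', hd'] at hij ⊢
    have he' : e = 1 ∨ e = -1 := Int.isUnit_iff.1 (IsUnit.of_mul_eq_one e he)
    have hf' : f = 1 ∨ f = -1 := Int.isUnit_iff.1 (IsUnit.of_mul_eq_one f hf)
    rcases he' with h | h <;> rcases hf' with h' | h' <;> rw [h, h'] at hij ⊢ <;> linarith

namespace SpecialPolygon

variable (P : SpecialPolygon)

/-- The special polygon as a subset of `ℍ`. -/
def region : Set UpperHalfPlane := ⋂ k, leftPart (P.kind k) (P.frame k)

/-- The ideal vertex `xₖ₋₁`, where the `k`-th boundary piece starts. -/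
def initialCusp (k : Fin (P.n + 2)) : ExtPoint := .ideal (cuspSeq P.x k.castSucc)

/-- The ideal vertex `xₖ`, where the `k`-th boundary piece ends. -/
def terminalCusp (k : Fin (P.n + 2)) : ExtPoint := .ideal (cuspSeq P.x k.succ)

/-- The common end point in `ℍ` of the two even edges that form the `k`-th boundary piece. -/
def evenPoint (k : Fin (P.n + 2)) : ExtPoint := .inner (P.frame k • UpperHalfPlane.I)

/-- The common end point in `ℍ` of the two odd edges that form the `k`-th boundary piece. -/
def oddPoint (k : Fin (P.n + 2)) : ExtPoint := .inner (P.frame k • rhoPoint)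

/-- The side pairing. Sides carry the orientation of the boundary of the polygon. -/
inductive SidePairing : OrientedArc → OrientedArc → Prop
  | even (k : Fin (P.n + 2)) (h : P.kind k = .even) :
      SidePairing ⟨P.initialCusp k, P.evenPoint k⟩ ⟨P.evenPoint k, P.terminalCusp k⟩
  | odd (k : Fin (P.n + 2)) (h : P.kind k = .odd) :
      SidePairing ⟨P.initialCusp k, P.oddPoint k⟩ ⟨P.oddPoint k, P.terminalCusp k⟩
  | free (k : Fin (P.n + 2)) (h : P.kind k = .free) :
      SidePairing ⟨P.initialCusp k, P.terminalCusp k⟩ ⟨P.initialCusp (P.partner k), P.terminalCusp (P.partner k)⟩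

/-- The group `Γ_P` generated by the side pairing transformations. -/
def group : Subgroup PSL(2, ℤ) :=
  Subgroup.closure {α | ∃ (γ : SL(2, ℤ)) (s t : OrientedArc),
    P.SidePairing s t ∧ MapsReversing γ s t ∧ α = QuotientGroup.mk γ}

/-- The numerator `aₖ₋₁` of the ideal vertex `xₖ₋₁`. -/
def a (k : Fin (P.n + 3)) : ℤ := numSeq P.x k

/-- The denominator `bₖ₋₁` of the ideal vertex `xₖ₋₁`. -/
def b (k : Fin (P.n + 3)) : ℤ := denSeq P.x k

/-- For `k = i + 1`, the matrix of determinant `1` with columns `(aᵢ, bᵢ)`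
and `-(aᵢ₊₁, bᵢ₊₁)`. It takes `∞` to `xᵢ` and `0` to `xᵢ₊₁`. -/
def phi (k : Fin (P.n + 2)) : SL(2, ℤ) :=
  ⟨!![P.a k.castSucc, -P.a k.succ; P.b k.castSucc, -P.b k.succ], by
    have h := farey_relation P.strictMono_x k (P.frame k) (P.frame_zero k) (P.frame_infty k)
    rw [Matrix.det_fin_two_of]
    simp only [a, b]
    linarith⟩

/-- For `k = i + 1`, the number `|aᵢ₋₁ bᵢ₊₁ - aᵢ₊₁ bᵢ₋₁|`, plus `1` if the pairing
between `xᵢ₋₁` and `xᵢ` is odd. Indices are cyclic: the vertex before `x₋₁ = ∞` is `xₙ`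
(`k - 1` is taken in `Fin (n + 2)`, so it is `n + 1` for `k = 0`). -/
def width (k : Fin (P.n + 2)) : ℕ :=
  (P.a (k - 1).castSucc * P.b k.succ - P.a k.succ * P.b (k - 1).castSucc).natAbs +
    match P.kind (k - 1) with
    | .odd => 1
    | _ => 0

end SpecialPolygon

end

/-! Cut every triangle of the Farey tessellation into three thirds meeting at its centre. The third
with corners `0`, `ρ`, `∞` is a fundamental domain, so elements `g` of PSL(2, ℤ) are tiles. With S :
z ↦ -1/z and U : z ↦ 1 - 1/z, the tile `gS` lies across the Farey edge of `g`, and `gU`, `gU²` lie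
in the same triangle. The polygon consists of the tiles of the Farey triangles spanned by its
vertices, plus one tile beyond each odd piece. Let J be this set of tiles; each right coset Γg turns
out to meet J exactly once, and inversion gives the left cosets.

Existence: a step that leaves J crosses a paired side, and a generator of Γ brings it back. Hence ΓJ
is stable under right multiplication by S and U, which generate the group
(`exists_mul_eq_of_transport`).

Uniqueness: gluing the sides turns the two steps into permutations σ, τ of J with σ² = τ³ = 1. Since
PSL(2, ℤ) is the free product of ℤ/2 and ℤ/3 (`exists_psl_hom`, by ping-pong), they extend to an
action. Steps inside J connect J, so transport along a⁻¹b takes the tile a to b, while a generator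
of Γ conjugated by a fixes a. So q = γp forces q = p (`eq_of_transport`). This replaces Poincaré's
polygon theorem.

Counting: with vertex vectors v, the Farey edges that leave vertex k end at j v_k - v_{k+1}. They
stay in the polygon exactly for 0 ≤ j ≤ fan, where fan is the determinant of the two neighbours of
v_k (`FareyCycle.isVertex_sub_iff`). The tile is inner for j < fan; at j = fan it is the preceding
boundary edge, which counts only if that piece is odd. This is the number w_i. -/

/-! ### The modular group as the free product of ℤ/2 and ℤ/3 -/

/-- The homomorphism from `ℤ/n` that takes the generator to an element with `n`-th power one. -/
def zmodPowHom {G : Type*} [Group G] (n : ℕ) (x : G) (hx : x ^ n = 1) :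
    Multiplicative (ZMod n) →* G :=
  AddMonoidHom.toMultiplicativeLeft
    (ZMod.lift n ⟨zmultiplesHom (Additive G) (Additive.ofMul x), by
      simpa using congrArg Additive.ofMul hx⟩)

lemma zmodPowHom_ofAdd_intCast {G : Type*} [Group G] (n : ℕ) (x : G) (hx : x ^ n = 1) (k : ℤ) :
    zmodPowHom n x hx (Multiplicative.ofAdd (k : ZMod n)) = x ^ k := by
  simp [zmodPowHom]

namespace ModularGroup

lemma S_mul_S : S * S = -1 := by
  ext i j; fin_cases i <;> fin_cases j <;> rfl

lemma TS_mul_TS : T * S * (T * S) = S * T⁻¹ := by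
  ext i j; fin_cases i <;> fin_cases j <;> rfl

lemma TS_mul_TS_mul_TS : T * S * (T * S) * (T * S) = -1 := by
  ext i j; fin_cases i <;> fin_cases j <;> rfl

lemma re_S_smul (z : UpperHalfPlane) : (S • z).re = -z.re / Complex.normSq z := by
  rw [UpperHalfPlane.modular_S_smul, UpperHalfPlane.mk_re, Complex.inv_re]
  simp

lemma re_S_smul_pos_iff (z : UpperHalfPlane) : 0 < (S • z).re ↔ z.re < 0 := by
  rw [re_S_smul, div_pos_iff_of_pos_right (UpperHalfPlane.normSq_pos z), neg_pos]

lemma re_S_smul_nonpos_iff (z : UpperHalfPlane) : (S • z).re ≤ 0 ↔ 0 ≤ z.re := by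
  rw [← not_lt, re_S_smul_pos_iff, not_lt]

lemma re_S_smul_neg_iff (z : UpperHalfPlane) : (S • z).re < 0 ↔ 0 < z.re := by
  rw [re_S_smul, div_neg_iff]
  simp [UpperHalfPlane.normSq_pos z, (UpperHalfPlane.normSq_pos z).not_gt]

lemma re_TS_smul_pos {z : UpperHalfPlane} (hz : z.re < 0) : 0 < ((T * S) • z).re := by
  rw [mul_smul, UpperHalfPlane.modular_T_smul, UpperHalfPlane.vadd_re]
  have := (re_S_smul_pos_iff z).2 hz
  positivity

lemma re_TS_mul_TS_smul_pos {z : UpperHalfPlane} (hz : z.re < 0) :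
    0 < ((T * S * (T * S)) • z).re := by
  rw [TS_mul_TS, mul_smul, re_S_smul_pos_iff]
  have h : T • T⁻¹ • z = z := smul_inv_smul _ _
  rw [UpperHalfPlane.modular_T_smul] at h
  have := congrArg UpperHalfPlane.re h
  rw [UpperHalfPlane.vadd_re] at this
  linarith

end ModularGroup

lemma psl_mk_eq_iff (g h : SL(2, ℤ)) :
    (QuotientGroup.mk g : PSL(2, ℤ)) = QuotientGroup.mk h ↔ h = g ∨ h = -g := by
  rw [QuotientGroup.eq, Matrix.SpecialLinearGroup.mem_center_iff]
  constructor
  · rintro ⟨r, hr, h1⟩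
    have hr' : r = 1 ∨ r = -1 := by
      rw [Fintype.card_fin] at hr
      exact Int.isUnit_iff.1 (IsUnit.of_mul_eq_one r (by rw [← pow_two, hr]))
    have h2 : g⁻¹ * h = 1 ∨ g⁻¹ * h = -1 := by
      rcases hr' with rfl | rfl
      · left; ext1; rw [← h1]; simp
      · right; ext1; rw [← h1]; simp
    rcases h2 with h2 | h2
    · left; rw [inv_mul_eq_iff_eq_mul] at h2; simpa using h2
    · right; rw [inv_mul_eq_iff_eq_mul] at h2; simpa using h2
  · rintro (rfl | rfl)
    · exact ⟨1, by simp, by simp⟩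
    · exact ⟨-1, by simp, by simp⟩

lemma psl_mk_neg (g : SL(2, ℤ)) : (QuotientGroup.mk (-g) : PSL(2, ℤ)) = QuotientGroup.mk g :=
  ((psl_mk_eq_iff _ _).2 (Or.inr rfl)).symm

/-- The class of `z ↦ -1 / z` in `PSL(2, ℤ)`. -/
def pslS : PSL(2, ℤ) := QuotientGroup.mk ModularGroup.S

/-- The class of `z ↦ 1 - 1 / z` in `PSL(2, ℤ)`. -/
def pslU : PSL(2, ℤ) := QuotientGroup.mk (ModularGroup.T * ModularGroup.S)

lemma pslS_mul_self : pslS * pslS = 1 := by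
  rw [pslS, ← QuotientGroup.mk_mul, ModularGroup.S_mul_S, psl_mk_neg, QuotientGroup.mk_one]

lemma pslU_mul_self_mul_self : pslU * pslU * pslU = 1 := by
  rw [pslU, ← QuotientGroup.mk_mul, ← QuotientGroup.mk_mul, ModularGroup.TS_mul_TS_mul_TS,
    psl_mk_neg, QuotientGroup.mk_one]

lemma mk_T_eq : (QuotientGroup.mk ModularGroup.T : PSL(2, ℤ)) = pslU * pslS := by
  rw [pslU, QuotientGroup.mk_mul, ← pslS, mul_assoc, pslS_mul_self, mul_one]

lemma closure_pslS_pslU : Subgroup.closure {pslS, pslU} = ⊤ := by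
  rw [eq_top_iff]
  rintro ⟨g⟩ -
  have hg : g ∈ Subgroup.closure {ModularGroup.S, ModularGroup.T} := by
    rw [SpecialLinearGroup.SL2Z_generators]
    trivial
  have h1 : (Subgroup.closure {ModularGroup.S, ModularGroup.T}).map
      (QuotientGroup.mk' (Subgroup.center SL(2, ℤ))) ≤ Subgroup.closure {pslS, pslU} := by
    rw [MonoidHom.map_closure, Subgroup.closure_le]
    have hs : pslS ∈ Subgroup.closure {pslS, pslU} := Subgroup.subset_closure (by simp)
    have hu : pslU ∈ Subgroup.closure {pslS, pslU} := Subgroup.subset_closure (by simp)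
    rintro _ ⟨x, rfl | rfl, rfl⟩
    · exact hs
    · change (QuotientGroup.mk ModularGroup.T : PSL(2, ℤ)) ∈ _
      rw [mk_T_eq]
      exact mul_mem hu hs
  exact h1 ⟨g, hg, rfl⟩

/-- The action of `PSL(2, ℤ)` on the upper half-plane. -/
noncomputable def pslPerm : PSL(2, ℤ) →* Equiv.Perm UpperHalfPlane :=
  QuotientGroup.lift _ (MulAction.toPermHom SL(2, ℤ) UpperHalfPlane) (by
    intro g hg
    have h1 : (QuotientGroup.mk 1 : PSL(2, ℤ)) = QuotientGroup.mk g := by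
      rw [QuotientGroup.eq]; simpa using hg
    ext1 z
    rcases (psl_mk_eq_iff _ _).1 h1 with rfl | rfl
    · simp
    · exact (ModularGroup.SL_neg_smul 1 z).trans (one_smul _ z))

lemma pslS_pow_two : pslS ^ 2 = 1 := by rw [pow_two, pslS_mul_self]

lemma pslU_pow_three : pslU ^ 3 = 1 := by rw [pow_three, ← mul_assoc, pslU_mul_self_mul_self]

/-- The orders of the free factors of `PSL(2, ℤ)`. -/
def factorOrder (b : Bool) : ℕ := cond b 3 2

/-- The generators of the free factors of `PSL(2, ℤ)`. -/
def factorGen (b : Bool) : PSL(2, ℤ) := cond b pslU pslS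

lemma factorGen_pow (b : Bool) : factorGen b ^ factorOrder b = 1 := by
  cases b
  · exact pslS_pow_two
  · exact pslU_pow_three

/-- The homomorphism `ℤ/2 * ℤ/3 → PSL(2, ℤ)`. -/
def freeProductHom : Monoid.CoprodI (fun b => Multiplicative (ZMod (factorOrder b))) →* PSL(2, ℤ) :=
  Monoid.CoprodI.lift fun b => zmodPowHom _ (factorGen b) (factorGen_pow b)

lemma freeProductHom_of (b : Bool) : freeProductHom
    (Monoid.CoprodI.of (i := b) (Multiplicative.ofAdd ((1 : ℤ) : ZMod (factorOrder b)))) =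
      factorGen b := by
  rw [freeProductHom, Monoid.CoprodI.lift_of, zmodPowHom_ofAdd_intCast, zpow_one]

/-- Ping-pong on the two halves of ℍ: S throws the right half into the left one, while U and U²
throw the left half into the right one. -/
lemma freeProductHom_injective : Function.Injective freeProductHom := by
  have key : Function.Injective (Monoid.CoprodI.lift fun b =>
      pslPerm.comp (zmodPowHom _ (factorGen b) (factorGen_pow b))) := by
    -- With only two factors, ping-pong needs one of them to have at least three elements; this is
    -- ℤ/3.
    refine Monoid.CoprodI.lift_injective_of_ping_pong _ (Or.inr ⟨true, ?_⟩)
      (α := UpperHalfPlane) (fun b => cond b {z | 0 < z.re} {z | z.re < 0}) ?_ ?_ ?_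
    · change (3 : Cardinal) ≤ Cardinal.mk (ZMod 3)
      simp
    · rintro (_ | _)
      · exact ⟨⟨⟨-1, 1⟩, one_pos⟩, by norm_num [UpperHalfPlane.mk_re]⟩
      · exact ⟨⟨⟨1, 1⟩, one_pos⟩, by norm_num [UpperHalfPlane.mk_re]⟩
    · rintro (_ | _) (_ | _) h
      · exact absurd rfl h
      · exact Set.disjoint_left.2 fun z (h1 : z.re < 0) (h2 : 0 < z.re) => h1.not_gt h2
      · exact Set.disjoint_left.2 fun z (h1 : 0 < z.re) (h2 : z.re < 0) => h1.not_gt h2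
      · exact absurd rfl h
    · rintro (_ | _) (_ | _) hij h h1
      · exact absurd rfl hij
      · rintro _ ⟨z, hz, rfl⟩
        have hh : h = Multiplicative.ofAdd ((1 : ℤ) : ZMod 2) := by
          change ZMod 2 at h
          fin_cases h
          · exact absurd rfl h1
          · rfl
        change (pslPerm (zmodPowHom 2 pslS pslS_pow_two h) z).re < 0
        rw [hh, zmodPowHom_ofAdd_intCast, zpow_one]
        exact (ModularGroup.re_S_smul_neg_iff z).2 hz
      · rintro _ ⟨z, hz, rfl⟩
        have hh : h = Multiplicative.ofAdd ((1 : ℤ) : ZMod 3) ∨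
            h = Multiplicative.ofAdd ((2 : ℤ) : ZMod 3) := by
          change ZMod 3 at h
          fin_cases h
          · exact absurd rfl h1
          · exact Or.inl rfl
          · exact Or.inr rfl
        change 0 < (pslPerm (zmodPowHom 3 pslU pslU_pow_three h) z).re
        rcases hh with hh | hh <;> rw [hh, zmodPowHom_ofAdd_intCast]
        · rw [zpow_one]
          exact ModularGroup.re_TS_smul_pos hz
        · rw [zpow_two]
          exact ModularGroup.re_TS_mul_TS_smul_pos hz
      · exact absurd rfl hij
  have h2 : (Monoid.CoprodI.lift fun b =>
      pslPerm.comp (zmodPowHom _ (factorGen b) (factorGen_pow b))) =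
        pslPerm.comp freeProductHom := by
    ext b x
    simp [freeProductHom]
  rw [h2] at key
  exact Function.Injective.of_comp (f := pslPerm) key

lemma freeProductHom_surjective : Function.Surjective freeProductHom := by
  rw [← MonoidHom.range_eq_top, eq_top_iff, ← closure_pslS_pslU, Subgroup.closure_le]
  rintro _ (rfl | rfl)
  · exact ⟨_, freeProductHom_of false⟩
  · exact ⟨_, freeProductHom_of true⟩

/-- `PSL(2, ℤ)` is the free product of the groups generated by `pslS` and `pslU`: the universal
property. -/
theorem exists_psl_hom {G : Type*} [Group G] (x y : G) (hx : x * x = 1) (hy : y * y * y = 1) :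
    ∃ ψ : PSL(2, ℤ) →* G, ψ pslS = x ∧ ψ pslU = y := by
  let e := MulEquiv.ofBijective freeProductHom
    ⟨freeProductHom_injective, freeProductHom_surjective⟩
  have hpow : ∀ b : Bool, (cond b y x) ^ factorOrder b = 1 := by
    rintro (_ | _)
    · simpa [factorOrder, pow_two] using hx
    · simpa [factorOrder, pow_three, mul_assoc] using hy
  let F : Monoid.CoprodI (fun b => Multiplicative (ZMod (factorOrder b))) →* G :=
    Monoid.CoprodI.lift fun b => zmodPowHom _ (cond b y x) (hpow b)
  have hF : ∀ b, F (e.symm (factorGen b)) = cond b y x := by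
    intro b
    rw [← freeProductHom_of b]
    have h1 : ∀ w, e.symm (freeProductHom w) = w := e.symm_apply_apply
    rw [h1, Monoid.CoprodI.lift_of, zmodPowHom_ofAdd_intCast, zpow_one]
  exact ⟨F.comp e.symm.toMonoidHom, hF false, hF true⟩

/-! ### Coset representatives from tiles with glued sides -/

section Tiles

variable {G : Type*} [Group G]

/-- If `Γ * J` is stable under right multiplication by generators of finite order, then it is the
whole group. -/
lemma exists_mul_eq_of_transport {s u : G} (hgen : Subgroup.closure {s, u} = ⊤) (hs : s * s = 1)
    (hu : u * u * u = 1) {J : Set G} (hJ : J.Nonempty) (Γ : Subgroup G)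
    (h1 : ∀ p ∈ J, ∃ γ ∈ Γ, ∃ q ∈ J, p * s = γ * q)
    (h2 : ∀ p ∈ J, ∃ γ ∈ Γ, ∃ q ∈ J, p * u = γ * q) (g : G) :
    ∃ γ ∈ Γ, ∃ p ∈ J, g = γ * p := by
  let A : G → Prop := fun g => ∃ γ ∈ Γ, ∃ p ∈ J, g = γ * p
  have hs' : ∀ g, A g → A (g * s) := by
    rintro _ ⟨γ, hγ, p, hp, rfl⟩
    obtain ⟨δ, hδ, q, hq, h⟩ := h1 p hp
    exact ⟨γ * δ, mul_mem hγ hδ, q, hq, by rw [mul_assoc, h, mul_assoc]⟩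
  have hu' : ∀ g, A g → A (g * u) := by
    rintro _ ⟨γ, hγ, p, hp, rfl⟩
    obtain ⟨δ, hδ, q, hq, h⟩ := h2 p hp
    exact ⟨γ * δ, mul_mem hγ hδ, q, hq, by rw [mul_assoc, h, mul_assoc]⟩
  have key : ∀ h : G, ∀ g, A g ↔ A (g * h) := by
    intro h
    have hh : h ∈ Subgroup.closure {s, u} := by rw [hgen]; trivial
    induction hh using Subgroup.closure_induction with
    | mem x hx =>
      -- The converse directions use the finite orders: g is gs·s and also gu·u·u.
      rcases hx with rfl | rfl
      · exact fun g => ⟨hs' g, fun h => by simpa [mul_assoc, hs] using hs' _ h⟩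
      · exact fun g => ⟨hu' g, fun h => by
          simpa [mul_assoc, (mul_assoc _ _ _).symm.trans hu] using hu' _ (hu' _ h)⟩
    | one => simp
    | mul x y _ _ hx hy => intro g; rw [hx, hy, mul_assoc]
    | inv x _ hx => intro g; rw [hx (g * x⁻¹), inv_mul_cancel_right]
  obtain ⟨p, hp⟩ := hJ
  have := (key (p⁻¹ * g) p).1 ⟨1, one_mem _, p, hp, by simp⟩
  rwa [mul_inv_cancel_left] at this

/-- If `G` acts on a set `J ⊆ G` of tiles from the right, through the neighbour maps `σ` and `τ`, and
the internal moves connect all tiles, then tiles that are equivalent under the group generated by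
the external moves are equal. -/
theorem eq_of_transport {s u : G} {J : Set G} (σ τ : Equiv.Perm J) (ψ : G →* Equiv.Perm J)
    (hψs : ψ s = σ) (hψu : ψ u = τ⁻¹) (hσ : σ * σ = 1)
    (hconn : ∀ r : G → G → Prop, Equivalence r →
      (∀ p : J, (σ p : G) = p * s → r p (σ p)) → (∀ p : J, (τ p : G) = p * u → r p (τ p)) →
      ∀ p ∈ J, ∀ q ∈ J, r p q)
    (R : Set G)
    (hR : ∀ γ ∈ R, (∃ p : J, γ * p * s = σ p) ∨ ∃ p : J, p * u = γ * τ p)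
    {γ p q : G} (hγ : γ ∈ Subgroup.closure R) (hp : p ∈ J) (hq : q ∈ J) (h : q = γ * p) :
    p = q := by
  have hinv : ∀ g h : G, ∀ x y : J, ψ (g⁻¹ * h) x = y → ψ (h⁻¹ * g) y = x := by
    rintro g h x _ rfl
    rw [← Equiv.Perm.mul_apply, ← map_mul]
    simp [mul_assoc]
  have hss : ∀ x, σ (σ x) = x := fun x => by rw [← Equiv.Perm.mul_apply, hσ]; rfl
  -- Right multiplication reverses products, so the step from a to b is the action of b⁻¹a rather
  -- than of a⁻¹b. By `hconn` it suffices to check single internal steps.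
  have hrel : ∀ a b : J, ψ ((b : G)⁻¹ * a) a = b := by
    intro a b
    have hr := hconn (fun g h => (g ∈ J ↔ h ∈ J) ∧
      ∀ (hg : g ∈ J) (hh : h ∈ J), ψ (h⁻¹ * g) ⟨g, hg⟩ = ⟨h, hh⟩) ?_ ?_ ?_ a a.2 b b.2
    · exact hr.2 a.2 b.2
    · refine ⟨fun x => ⟨Iff.rfl, fun _ _ => by simp⟩,
        fun hxy => ⟨hxy.1.symm, fun hg hh => hinv _ _ _ _ (hxy.2 hh hg)⟩,
        fun {x y z} hxy hyz => ⟨hxy.1.trans hyz.1, fun hx hz => ?_⟩⟩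
      have hy := hxy.1.1 hx
      rw [← hyz.2 hy hz, ← hxy.2 hx hy, ← Equiv.Perm.mul_apply, ← map_mul]
      simp [mul_assoc]
    · intro p hp
      refine ⟨iff_of_true p.2 (σ p).2, fun _ _ => ?_⟩
      have : ((σ p : G))⁻¹ * p = s⁻¹ := by rw [hp]; simp
      rw [this, map_inv, hψs, Subtype.coe_eta, Subtype.coe_eta, Equiv.Perm.inv_eq_iff_eq, hss]
    · intro p hp
      refine ⟨iff_of_true p.2 (τ p).2, fun _ _ => ?_⟩
      have : ((τ p : G))⁻¹ * p = u⁻¹ := by rw [hp]; simp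
      rw [this, map_inv, hψu, inv_inv]
  -- Following a generator of Γ from a means going to a side, crossing it and returning. The glued
  -- crossing closes this path up in J.
  have hfix : ∀ a : J, ψ ((a : G)⁻¹ * γ⁻¹ * a) a = a := by
    clear h
    induction hγ using Subgroup.closure_induction with
    | mem x hx =>
      intro a
      rcases hR x hx with ⟨p, h⟩ | ⟨p, h⟩
      · have h1 : (a : G)⁻¹ * x⁻¹ * a = ((a : G)⁻¹ * p) * s * ((σ p : G)⁻¹ * a) := by
          rw [← h]; group
        rw [h1, map_mul, map_mul, Equiv.Perm.mul_apply, Equiv.Perm.mul_apply, hrel, hψs, hss, hrel]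
      · have h1 : (a : G)⁻¹ * x⁻¹ * a = ((a : G)⁻¹ * τ p) * u⁻¹ * ((p : G)⁻¹ * a) := by
          rw [eq_mul_inv_of_mul_eq h.symm]; group
        rw [h1, map_mul, map_mul, Equiv.Perm.mul_apply, Equiv.Perm.mul_apply, hrel, map_inv, hψu,
          inv_inv, hrel]
    | one => simp
    | mul x y _ _ hx hy =>
      intro a
      have h1 : (a : G)⁻¹ * (x * y)⁻¹ * a = ((a : G)⁻¹ * y⁻¹ * a) * ((a : G)⁻¹ * x⁻¹ * a) := by
        group
      rw [h1, map_mul, Equiv.Perm.mul_apply, hx, hy]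
    | inv x _ hx =>
      intro a
      have h1 : (a : G)⁻¹ * x⁻¹⁻¹ * a = ((a : G)⁻¹ * x⁻¹ * a)⁻¹ := by group
      rw [h1, map_inv, Equiv.Perm.inv_eq_iff_eq, hx]
  have h1 := hrel ⟨p, hp⟩ ⟨q, hq⟩
  have h2 := hfix ⟨p, hp⟩
  simp only [h, mul_inv_rev] at h1
  rw [h1] at h2
  rw [h]
  exact (congrArg Subtype.val h2).symm

end Tiles

/-- Tiles `J` of a polygon: the set `I` of inner tiles, which is stable under `pslU`, and the
boundary edges `f k` with `odd k`. They represent the cosets of the group generated by the side pairings. -/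
theorem isComplement_inv_tiles {ι : Type*} (I : Set PSL(2, ℤ)) (f : ι → PSL(2, ℤ))
    (odd : ι → Prop) (partner : ι → ι) (hpp : ∀ k, partner (partner k) = k)
    (hpo : ∀ k, ¬ odd k → ¬ odd (partner k)) (hf : Function.Injective f)
    (hIU : ∀ g ∈ I, g * pslU ∈ I) (hIS : ∀ g ∈ I, g * pslS ∈ I ∪ Set.range f)
    (hfS : ∀ k, f k * pslS ∈ I ∪ Set.range f) (hfI : ∀ k, f k ∉ I)
    (J : Set PSL(2, ℤ)) (hJ : J = I ∪ f '' {k | odd k}) (hne : J.Nonempty)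
    (hnd : ∀ k, ¬ odd k → f k * pslS ∈ J)
    (hconn : ∀ r : PSL(2, ℤ) → PSL(2, ℤ) → Prop, Equivalence r →
      (∀ p ∈ J, p * pslS ∈ J → r p (p * pslS)) → (∀ p ∈ I, r p (p * pslU)) →
      ∀ p ∈ J, ∀ q ∈ J, r p q) :
    Subgroup.IsComplement J⁻¹ (Subgroup.closure
      {γ | ∃ k, (¬ odd k ∧ γ = f (partner k) * pslS * (f k)⁻¹) ∨
        (odd k ∧ γ = f k * pslU * (f k)⁻¹)} : Set PSL(2, ℤ)) := by
  classical
  set R : Set PSL(2, ℤ) := {γ | ∃ k, (¬ odd k ∧ γ = f (partner k) * pslS * (f k)⁻¹) ∨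
        (odd k ∧ γ = f k * pslU * (f k)⁻¹)} with hR
  have hIJ : ∀ g ∈ I, g ∈ J := fun g hg => by rw [hJ]; exact Or.inl hg
  have hoJ : ∀ k, odd k → f k ∈ J := fun k hk => by rw [hJ]; exact Or.inr ⟨k, hk, rfl⟩
  have hSS : ∀ g, g * pslS * pslS = g := fun g => by rw [mul_assoc, pslS_mul_self, mul_one]
  have hUUU : ∀ g, g * pslU * pslU * pslU = g := fun g => by
    rw [mul_assoc, mul_assoc, ← mul_assoc pslU, pslU_mul_self_mul_self, mul_one]
  have hfJ : ∀ k, ¬ odd k → f k ∉ J := by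
    rintro k hk h
    rw [hJ] at h
    rcases h with h | ⟨m, hm, h⟩
    · exact hfI k h
    · exact hk (hf h ▸ hm)
  have hmem : ∀ g, g ∈ I ∪ Set.range f → (∀ k, ¬ odd k → g ≠ f k) → g ∈ J := by
    rintro g (h | ⟨k, rfl⟩) hg
    · exact hIJ g h
    · exact hoJ k (by_contra fun h => hg k h rfl)
  have hEJ : J ⊆ I ∪ Set.range f := by
    rw [hJ]; exact Set.union_subset_union_right _ (Set.image_subset_range _ _)
  have hES : ∀ g ∈ J, g * pslS ∈ I ∪ Set.range f := by
    intro g hg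
    rcases hEJ hg with h | ⟨k, rfl⟩
    exacts [hIS g h, hfS k]
  -- Crossing the Farey edge of p either stays in J or runs out through a piece k that is not odd;
  -- then one re-enters through its partner.
  have hσ : ∀ p : J, ∃ q : J, ((∀ k, ¬ odd k → (p : PSL(2, ℤ)) * pslS ≠ f k) ∧
      (q : PSL(2, ℤ)) = p * pslS) ∨ ∃ k, ¬ odd k ∧ (p : PSL(2, ℤ)) * pslS = f k ∧
      (q : PSL(2, ℤ)) = f (partner k) * pslS := by
    intro p
    by_cases h : ∀ k, ¬ odd k → (p : PSL(2, ℤ)) * pslS ≠ f k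
    · exact ⟨⟨_, hmem _ (hES _ p.2) h⟩, Or.inl ⟨h, rfl⟩⟩
    · push Not at h
      obtain ⟨k, hk, h⟩ := h
      exact ⟨⟨_, hnd _ (hpo k hk)⟩, Or.inr ⟨k, hk, h, rfl⟩⟩
  choose σ hσ using hσ
  have hσσ : ∀ p, σ (σ p) = p := by
    intro p
    apply Subtype.ext
    rcases hσ p with ⟨h1, h2⟩ | ⟨k, hk, h1, h2⟩
    · rcases hσ (σ p) with ⟨h3, h4⟩ | ⟨m, hm, h3, h4⟩
      · rw [h4, h2, hSS]
      · rw [h2, hSS] at h3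
        exact absurd (h3 ▸ p.2) (hfJ m hm)
    · have h5 : (σ p : PSL(2, ℤ)) * pslS = f (partner k) := by rw [h2, hSS]
      rcases hσ (σ p) with ⟨h3, h4⟩ | ⟨m, hm, h3, h4⟩
      · exact absurd h5 (h3 _ (hpo k hk))
      · rw [h5] at h3
        rw [h4, ← hf h3, hpp, ← h1, hSS]
  -- The tile beyond an odd piece is fixed: its rotation about the odd point is itself a side
  -- pairing.
  have hτ : ∀ p : J, ∃ q : J, ((p : PSL(2, ℤ)) ∈ I ∧ (q : PSL(2, ℤ)) = p * pslU) ∨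
      ((p : PSL(2, ℤ)) ∉ I ∧ q = p) := by
    intro p
    by_cases h : (p : PSL(2, ℤ)) ∈ I
    · exact ⟨⟨_, hIJ _ (hIU _ h)⟩, Or.inl ⟨h, rfl⟩⟩
    · exact ⟨p, Or.inr ⟨h, rfl⟩⟩
  choose τ hτ using hτ
  have hτI : ∀ p : J, (p : PSL(2, ℤ)) ∈ I → (τ p : PSL(2, ℤ)) = p * pslU := fun p hp =>
    (hτ p).elim And.right fun h => absurd hp h.1
  have hτn : ∀ p : J, (p : PSL(2, ℤ)) ∉ I → τ p = p := fun p hp =>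
    (hτ p).elim (fun h => absurd h.1 hp) And.right
  have hτττ : ∀ p, τ (τ (τ p)) = p := by
    intro p
    by_cases hp : (p : PSL(2, ℤ)) ∈ I
    · have h1 := hτI p hp
      have hp1 : (τ p : PSL(2, ℤ)) ∈ I := h1 ▸ hIU _ hp
      have h2 := hτI _ hp1
      have hp2 : (τ (τ p) : PSL(2, ℤ)) ∈ I := h2 ▸ hIU _ hp1
      apply Subtype.ext
      rw [hτI _ hp2, h2, h1, hUUU]
    · rw [hτn p hp, hτn p hp, hτn p hp]
  let σ' : Equiv.Perm J := ⟨σ, σ, hσσ, hσσ⟩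
  let τ' : Equiv.Perm J := ⟨τ, fun p => τ (τ p), hτττ, hτττ⟩
  have hσ' : σ' * σ' = 1 := Equiv.ext hσσ
  have hτ' : τ' * τ' * τ' = 1 := Equiv.ext hτττ
  -- The inverse of τ is used because right multiplication is an anti-action; σ is its own inverse.
  obtain ⟨ψ, hψS, hψU⟩ := exists_psl_hom σ' τ'⁻¹ hσ' (by
    rw [← mul_inv_rev, ← mul_inv_rev, ← mul_assoc, hτ', inv_one])
  have huniq : ∀ {γ p q : PSL(2, ℤ)}, γ ∈ Subgroup.closure R → p ∈ J → q ∈ J → q = γ * p →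
      p = q := by
    refine eq_of_transport σ' τ' ψ hψS hψU hσ' (fun r hr h1 h2 => hconn r hr ?_ ?_) R ?_
    · intro p hp hpS
      have : (σ ⟨p, hp⟩ : PSL(2, ℤ)) = p * pslS := by
        rcases hσ ⟨p, hp⟩ with h | ⟨k, hk, h, -⟩
        · exact h.2
        · exact absurd (h ▸ hpS) (hfJ k hk)
      rw [← this]
      exact h1 ⟨p, hp⟩ this
    · intro p hp
      have := hτI ⟨p, hIJ _ hp⟩ hp
      rw [← this]
      exact h2 _ this
    · rintro γ ⟨k, ⟨hk, rfl⟩ | ⟨hk, rfl⟩⟩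
      · refine Or.inl ⟨⟨_, hnd k hk⟩, ?_⟩
        rcases hσ ⟨_, hnd k hk⟩ with h | ⟨m, hm, h, h'⟩
        · exact absurd (hSS (f k)) (h.1 k hk)
        · change _ = ((σ _ : J) : PSL(2, ℤ))
          have h : f k * pslS * pslS = f m := h
          rw [hSS] at h
          rw [h', ← hf h]
          simp [mul_assoc, pslS_mul_self]
      · refine Or.inr ⟨⟨f k, hoJ k hk⟩, ?_⟩
        change _ = _ * ((τ _ : J) : PSL(2, ℤ))
        rw [hτn _ (hfI k)]
        simp
  have hRmem : ∀ γ ∈ R, γ ∈ Subgroup.closure R := fun γ hγ => Subgroup.subset_closure hγ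
  have hex := exists_mul_eq_of_transport closure_pslS_pslU pslS_mul_self pslU_mul_self_mul_self hne
    (Subgroup.closure R)
    (by
      intro p hp
      rcases hσ ⟨p, hp⟩ with h | ⟨k, hk, h, -⟩
      · exact ⟨1, one_mem _, _, (σ ⟨p, hp⟩).2, by rw [h.2, one_mul]⟩
      · refine ⟨_, inv_mem (hRmem _ ⟨k, Or.inl ⟨hk, rfl⟩⟩), _, hnd _ (hpo k hk), ?_⟩
        rw [h]
        group)
    (by
      intro p hp
      have hp' := hp
      rw [hJ] at hp'
      rcases hp' with h | ⟨k, hk, rfl⟩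
      · exact ⟨1, one_mem _, _, hIJ _ (hIU p h), by rw [one_mul]⟩
      · exact ⟨_, hRmem _ ⟨k, Or.inr ⟨hk, rfl⟩⟩, _, hp, by group⟩)
  rw [Subgroup.isComplement_iff_existsUnique]
  intro g
  obtain ⟨γ, hγ, p, hp, h⟩ := hex g⁻¹
  refine ⟨⟨⟨p⁻¹, Set.inv_mem_inv.2 hp⟩, ⟨γ⁻¹, inv_mem hγ⟩⟩, ?_, ?_⟩
  · change p⁻¹ * γ⁻¹ = g
    rw [← mul_inv_rev, ← h, inv_inv]
  · rintro ⟨⟨q, hq⟩, ⟨δ, hδ⟩⟩ h'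
    change q * δ = g at h'
    have h1 : q⁻¹ = δ * γ * p := by
      rw [mul_assoc, ← h, ← h']; group
    have h2 := huniq (mul_mem hδ hγ) hp hq h1
    have h3 : q = p⁻¹ := by rw [h2, inv_inv]
    subst h3
    have h4 : δ = γ⁻¹ := by
      rw [eq_inv_iff_mul_eq_one]
      rw [inv_inv] at h1
      exact (mul_eq_right.1 h1.symm)
    subst h4
    rfl

/-! ### Ideal polygons in the Farey tessellation -/

/-- The vectors `(a k, b k)` of the vertices of an ideal polygon with `n + 2` vertices whose sides
are edges of the Farey tessellation; one turn changes the sign. -/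
structure FareyCycle (n : ℕ) where
  a : ℤ → ℤ
  b : ℤ → ℤ
  a_add : ∀ k, a (k + (n + 2)) = -a k
  b_add : ∀ k, b (k + (n + 2)) = -b k
  det_succ : ∀ k, a (k + 1) * b k - a k * b (k + 1) = 1
  det_pos : ∀ k m : ℤ, k < m → m < k + (n + 2) → 0 < a m * b k - a k * b m

namespace FareyCycle

variable {n : ℕ} (C : FareyCycle n)

/-- The vector `(p, q)` represents a vertex. -/
def IsVertex (p q : ℤ) : Prop := ∃ m, p = C.a m ∧ q = C.b m

/-- The number of triangles at the `k`-th vertex. -/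
def fan (k : ℤ) : ℤ := C.a (k + 1) * C.b (k - 1) - C.a (k - 1) * C.b (k + 1)

/-- The matrix that takes `∞` to the `k`-th vertex and `0` to the next one. -/
def corner (k : ℤ) : SL(2, ℤ) :=
  ⟨!![C.a k, -C.a (k + 1); C.b k, -C.b (k + 1)], by
    rw [Matrix.det_fin_two_of]; linarith [C.det_succ k]⟩

/-- The matrix that takes `0` to the `k`-th vertex and `∞` to the next one. -/
def edge (k : ℤ) : SL(2, ℤ) :=
  ⟨!![C.a (k + 1), C.a k; C.b (k + 1), C.b k], by
    rw [Matrix.det_fin_two_of]; linarith [C.det_succ k]⟩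

/-- `g` takes `0` and `∞` to vertices. -/
def IsEdge (g : SL(2, ℤ)) : Prop := C.IsVertex (g 0 0) (g 1 0) ∧ C.IsVertex (g 0 1) (g 1 1)

/-- `g` takes `0`, `1` and `∞` to vertices. -/
def IsInner (g : SL(2, ℤ)) : Prop := C.IsEdge g ∧ C.IsVertex (g 0 0 + g 0 1) (g 1 0 + g 1 1)

variable {C} in
lemma IsVertex.neg {p q : ℤ} (h : C.IsVertex p q) : C.IsVertex (-p) (-q) := by
  obtain ⟨m, rfl, rfl⟩ := h
  exact ⟨m + (n + 2), (C.a_add m).symm, (C.b_add m).symm⟩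

lemma isVertex (m : ℤ) : C.IsVertex (C.a m) (C.b m) := ⟨m, rfl, rfl⟩

/-- A single sign serves the vertex and both neighbours, so matrices built from adjacent vertices
change at most by a global sign. -/
lemma add_mul_eq (k c : ℤ) :
    (C.a (k + c * (n + 2)) = C.a k ∧ C.b (k + c * (n + 2)) = C.b k ∧
      C.a (k + c * (n + 2) + 1) = C.a (k + 1) ∧ C.b (k + c * (n + 2) + 1) = C.b (k + 1) ∧
      C.a (k + c * (n + 2) - 1) = C.a (k - 1) ∧ C.b (k + c * (n + 2) - 1) = C.b (k - 1)) ∨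
    (C.a (k + c * (n + 2)) = -C.a k ∧ C.b (k + c * (n + 2)) = -C.b k ∧
      C.a (k + c * (n + 2) + 1) = -C.a (k + 1) ∧ C.b (k + c * (n + 2) + 1) = -C.b (k + 1) ∧
      C.a (k + c * (n + 2) - 1) = -C.a (k - 1) ∧ C.b (k + c * (n + 2) - 1) = -C.b (k - 1)) := by
  have hstep : ∀ c : ℤ, ∀ i : ℤ,
      C.a (k + (c + 1) * (n + 2) + i) = -C.a (k + c * (n + 2) + i) ∧
      C.b (k + (c + 1) * (n + 2) + i) = -C.b (k + c * (n + 2) + i) := by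
    intro c i
    rw [← C.a_add, ← C.b_add]
    constructor <;> congr 1 <;> ring
  have hstep0 : ∀ c : ℤ, C.a (k + (c + 1) * (n + 2)) = -C.a (k + c * (n + 2)) ∧
      C.b (k + (c + 1) * (n + 2)) = -C.b (k + c * (n + 2)) := fun c => by
    simpa using hstep c 0
  induction c using Int.induction_on with
  | zero => left; simp
  | succ c ih =>
    obtain ⟨h1, h2⟩ := hstep0 c
    obtain ⟨h3, h4⟩ := hstep c 1
    obtain ⟨h5, h6⟩ := hstep c (-1)
    simp only [← sub_eq_add_neg] at h5 h6
    rw [h1, h2, h3, h4, h5, h6]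
    simp only [neg_eq_iff_eq_neg, neg_neg] at ih ⊢
    exact ih.symm
  | pred c ih =>
    obtain ⟨h1, h2⟩ := hstep0 (-c - 1)
    obtain ⟨h3, h4⟩ := hstep (-c - 1) 1
    obtain ⟨h5, h6⟩ := hstep (-c - 1) (-1)
    simp only [← sub_eq_add_neg, sub_add_cancel] at h1 h2 h3 h4 h5 h6
    rw [h1, h2, h3, h4, h5, h6] at ih
    simp only [neg_eq_iff_eq_neg, neg_neg] at ih ⊢
    exact ih.symm

lemma exists_fin (k : ℤ) : ∃ m : Fin (n + 2), ∃ c : ℤ, k = (m : ℕ) + c * (n + 2) := by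
  have h0 : (0 : ℤ) < n + 2 := by positivity
  have h1 := Int.emod_nonneg k h0.ne'
  have h2 := Int.emod_lt_of_pos k h0
  refine ⟨⟨(k % (n + 2)).toNat, by omega⟩, k / (n + 2), ?_⟩
  rw [Fin.val_mk, Int.toNat_of_nonneg h1, mul_comm]
  exact (Int.emod_add_mul_ediv k (n + 2)).symm

/-- Brings any vertex, up to sign, into the one-turn window where `det_pos` applies. -/
lemma exists_between (k m : ℤ) : ∃ m', k ≤ m' ∧ m' < k + (n + 2) ∧
    ((C.a m = C.a m' ∧ C.b m = C.b m') ∨ (C.a m = -C.a m' ∧ C.b m = -C.b m')) := by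
  obtain ⟨i, c, h⟩ := exists_fin (n := n) (m - k)
  refine ⟨k + (i : ℕ), by omega, by omega, ?_⟩
  have hm : m = k + (i : ℕ) + c * (n + 2) := by linarith
  rw [hm]
  rcases C.add_mul_eq (k + (i : ℕ)) c with h | h
  · exact Or.inl ⟨h.1, h.2.1⟩
  · exact Or.inr ⟨h.1, h.2.1⟩

lemma mk_corner_add (k c : ℤ) :
    (QuotientGroup.mk (C.corner (k + c * (n + 2))) : PSL(2, ℤ)) = QuotientGroup.mk (C.corner k) := by
  rw [psl_mk_eq_iff]
  rcases C.add_mul_eq k c with ⟨h1, h2, h3, h4, -⟩ | ⟨h1, h2, h3, h4, -⟩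
  · left; ext i j; fin_cases i <;> fin_cases j <;> simp [corner, *]
  · right
    apply Subtype.ext
    rw [Matrix.SpecialLinearGroup.coe_neg]
    ext i j; fin_cases i <;> fin_cases j <;> simp [corner, *]

lemma mk_edge_add (k c : ℤ) :
    (QuotientGroup.mk (C.edge (k + c * (n + 2))) : PSL(2, ℤ)) = QuotientGroup.mk (C.edge k) := by
  rw [psl_mk_eq_iff]
  rcases C.add_mul_eq k c with ⟨h1, h2, h3, h4, -⟩ | ⟨h1, h2, h3, h4, -⟩
  · left; ext i j; fin_cases i <;> fin_cases j <;> simp [edge, *]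
  · right
    apply Subtype.ext
    rw [Matrix.SpecialLinearGroup.coe_neg]
    ext i j; fin_cases i <;> fin_cases j <;> simp [edge, *]

lemma fan_add (k c : ℤ) : C.fan (k + c * (n + 2)) = C.fan k := by
  rcases C.add_mul_eq k c with ⟨-, -, h3, h4, h5, h6⟩ | ⟨-, -, h3, h4, h5, h6⟩
  · simp only [fan, h3, h4, h5, h6]
  · simp only [fan, h3, h4, h5, h6]; ring

lemma fan_nonneg (k : ℤ) : 0 ≤ C.fan k := by
  rcases Nat.eq_zero_or_pos n with rfl | hn
  · have h1 := C.a_add (k - 1)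
    have h2 := C.b_add (k - 1)
    rw [show k - 1 + ((0 : ℕ) + 2) = k + 1 by push_cast; ring] at h1 h2
    rw [fan, h1, h2]
    apply le_of_eq; ring
  · exact (C.det_pos (k - 1) (k + 1) (by omega) (by omega)).le

lemma fan_pos (hn : 0 < n) (k : ℤ) : 0 < C.fan k :=
  C.det_pos (k - 1) (k + 1) (by omega) (by omega)

lemma fan_eq_zero (hn : n = 0) (k : ℤ) : C.fan k = 0 := by
  subst hn
  have h1 := C.a_add (k - 1)
  have h2 := C.b_add (k - 1)
  rw [show k - 1 + ((0 : ℕ) + 2) = k + 1 by push_cast; ring] at h1 h2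
  rw [fan, h1, h2]; ring

lemma det_pred (k : ℤ) : C.a k * C.b (k - 1) - C.a (k - 1) * C.b k = 1 := by
  simpa using C.det_succ (k - 1)

/-- Both neighbours have determinant one with v_k, with opposite signs, so their sum is a multiple
of v_k. -/
lemma a_rec (k : ℤ) : C.a (k - 1) + C.a (k + 1) = C.fan k * C.a k := by
  have h1 := C.det_succ k
  have h2 := C.det_pred k
  rw [fan]
  linear_combination -C.a (k - 1) * h1 - C.a (k + 1) * h2

lemma b_rec (k : ℤ) : C.b (k - 1) + C.b (k + 1) = C.fan k * C.b k := by
  have h1 := C.det_succ k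
  have h2 := C.det_pred k
  rw [fan]
  linear_combination -C.b (k - 1) * h1 - C.b (k + 1) * h2

lemma corner_mul_T_zpow (k j : ℤ) : (↑(C.corner k * ModularGroup.T ^ j) : Matrix (Fin 2) (Fin 2) ℤ) =
    !![C.a k, j * C.a k - C.a (k + 1); C.b k, j * C.b k - C.b (k + 1)] := by
  rw [Matrix.SpecialLinearGroup.coe_mul, ModularGroup.coe_T_zpow]
  simp only [corner, Matrix.mul_fin_two]
  congr 1
  ext i j; fin_cases i <;> fin_cases j <;> simp <;> ring

lemma edge_mul_S (k : ℤ) : C.edge k * ModularGroup.S = C.corner k := by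
  apply Subtype.ext
  rw [Matrix.SpecialLinearGroup.coe_mul, ModularGroup.coe_S]
  ext i j; fin_cases i <;> fin_cases j <;> simp [edge, corner, Matrix.mul_apply]

/-- Turning through the whole fan at a vertex ends on the boundary edge that arrives there. -/
lemma corner_mul_T_fan (k : ℤ) : C.corner k * ModularGroup.T ^ C.fan k = C.edge (k - 1) := by
  apply Subtype.ext
  rw [corner_mul_T_zpow]
  have h1 := C.a_rec k
  have h2 := C.b_rec k
  ext i j; fin_cases i <;> fin_cases j <;> simp [edge] <;> linarith

/-- For a vertex, j and fan - j are determinants with the two neighbours of v_k, hence nonnegative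
by cyclic order. Conversely, a non-vertex in the fan would have to lie strictly between two
consecutive vertices, and Farey edges do not cross. -/
lemma isVertex_sub_iff (k j : ℤ) :
    C.IsVertex (j * C.a k - C.a (k + 1)) (j * C.b k - C.b (k + 1)) ↔ 0 ≤ j ∧ j ≤ C.fan k := by
  have hk := C.det_succ k
  have hk' := C.det_pred k
  constructor
  · rintro ⟨m, h1, h2⟩
    obtain ⟨m', hm1, hm2, hm⟩ := C.exists_between k m
    have hne : m' ≠ k := by
      rintro rfl
      rcases hm with ⟨h3, h4⟩ | ⟨h3, h4⟩ <;> rw [h3] at h1 <;> rw [h4] at h2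
      · have : (0 : ℤ) = 1 := by
          linear_combination C.b m' * h1 - C.a m' * h2 + hk
        omega
      · have : (0 : ℤ) = 1 := by
          linear_combination C.b m' * h1 - C.a m' * h2 + hk
        omega
    have hpos := C.det_pos k m' (by omega) hm2
    have h5 : C.a m' = C.a (k + 1) - j * C.a k ∧ C.b m' = C.b (k + 1) - j * C.b k := by
      rcases hm with ⟨h3, h4⟩ | ⟨h3, h4⟩ <;> rw [h3] at h1 <;> rw [h4] at h2
      -- With this sign the determinant with v_k would be -1, against the cyclic order.
      · exfalso
        have : C.a m' * C.b k - C.a k * C.b m' = -1 := by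
          rw [← h1, ← h2]; linear_combination -hk
        omega
      · constructor <;> linarith
    obtain ⟨h5, h6⟩ := h5
    have e1 : C.a m' * C.b (k + 1) - C.a (k + 1) * C.b m' = j := by
      rw [h5, h6]; linear_combination j * hk
    have e2 : C.a m' * C.b (k - 1) - C.a (k - 1) * C.b m' = C.fan k - j := by
      rw [h5, h6, fan]; linear_combination -j * hk'
    constructor
    · rcases eq_or_ne m' (k + 1) with h | h
      · rw [h] at e1; apply le_of_eq; rw [← e1]; ring
      · rw [← e1]; exact (C.det_pos (k + 1) m' (by omega) (by omega)).le
    · have : 0 ≤ C.fan k - j := by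
        rw [← e2]
        rcases eq_or_ne m' (k - 1 + (n + 2)) with h | h
        · rw [h, C.a_add, C.b_add]; apply le_of_eq; ring
        · exact (C.det_pos (k - 1) m' (by omega) (by omega)).le
      omega
  · rintro ⟨hj0, hj1⟩
    by_contra hcon
    set y₁ := j * C.a k - C.a (k + 1) with hy₁
    set y₂ := j * C.b k - C.b (k + 1) with hy₂
    have hy : y₂ * C.a k - y₁ * C.b k = 1 := by
      rw [hy₁, hy₂]; linear_combination hk
    -- Cramer's rule in the unimodular basis v_m, v_{m+1}.
    have hplu : ∀ m, y₁ = (y₁ * C.b (m + 1) - C.a (m + 1) * y₂) * C.a m * (-1) +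
        (y₁ * C.b m - C.a m * y₂) * C.a (m + 1) ∧
        y₂ = (y₁ * C.b (m + 1) - C.a (m + 1) * y₂) * C.b m * (-1) +
        (y₁ * C.b m - C.a m * y₂) * C.b (m + 1) := by
      intro m
      have h := C.det_succ m
      constructor
      · linear_combination -y₁ * h
      · linear_combination -y₂ * h
    have hzero : ∀ m, y₁ * C.b m - C.a m * y₂ ≠ 0 := by
      intro m h0
      obtain ⟨h1, h2⟩ := hplu m
      rw [h0] at h1 h2
      set F := y₁ * C.b (m + 1) - C.a (m + 1) * y₂
      have hu : F * (C.a m * C.b k - C.a k * C.b m) = 1 := by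
        rw [h1, h2] at hy
        linear_combination hy
      rcases Int.isUnit_iff.1 (IsUnit.of_mul_eq_one _ hu) with h | h <;> rw [h] at h1 h2
      · exact hcon (by rw [h1, h2]; simpa using (C.isVertex m).neg)
      · exact hcon (by rw [h1, h2]; simpa using C.isVertex m)
    -- The determinant of y with v_m starts negative and can never become positive; at the last
    -- neighbour of v_k it equals fan - j, which contradicts j ≤ fan.
    have hneg : ∀ m, k + 1 ≤ m → m ≤ k + (n + 1) → y₁ * C.b m - C.a m * y₂ < 0 := by
      intro m hm
      induction m, hm using Int.leInduction with
      | base =>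
        intro _
        refine lt_of_le_of_ne ?_ (hzero _)
        have : y₁ * C.b (k + 1) - C.a (k + 1) * y₂ = -j := by
          rw [hy₁, hy₂]; linear_combination -j * hk
        omega
      | succ m hm ih =>
        intro hm2
        have h1 := ih (by omega)
        refine lt_of_le_of_ne ?_ (hzero _)
        by_contra! h2
        obtain ⟨h3, h4⟩ := hplu m
        have p1 := C.det_pos k m (by omega) (by omega)
        have p2 := C.det_pos k (m + 1) (by omega) (by omega)
        -- A sign change would write 1 as a sum of two positive integers.
        have e : (y₁ * C.b (m + 1) - C.a (m + 1) * y₂) * (C.a m * C.b k - C.a k * C.b m) -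
            (y₁ * C.b m - C.a m * y₂) * (C.a (m + 1) * C.b k - C.a k * C.b (m + 1)) = 1 := by
          linear_combination hy + C.b k * h3 - C.a k * h4
        nlinarith [mul_le_mul h2 p1 (by norm_num) h2.le,
          mul_pos (neg_pos.2 h1) p2]
    have hlast := hneg (k + (n + 1)) (by omega) le_rfl
    have h1 := C.a_add (k - 1)
    have h2 := C.b_add (k - 1)
    rw [show k - 1 + ((n : ℤ) + 2) = k + (n + 1) by ring] at h1 h2
    have e : y₁ * C.b (k + (n + 1)) - C.a (k + (n + 1)) * y₂ = C.fan k - j := by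
      rw [h1, h2, hy₁, hy₂, fan]; linear_combination -j * hk'
    omega

/-- The first column selects the vertex k; determinant one then determines the second column up to
multiples of v_k. -/
lemma isEdge_iff (g : SL(2, ℤ)) :
    C.IsEdge g ↔ ∃ k j : ℤ, 0 ≤ j ∧ j ≤ C.fan k ∧ g = C.corner k * ModularGroup.T ^ j := by
  constructor
  · rintro ⟨⟨k, h1, h2⟩, h3⟩
    have hdet : g 0 0 * g 1 1 - g 0 1 * g 1 0 = 1 := by
      have := g.det_coe
      rwa [Matrix.det_fin_two] at this
    have hk := C.det_succ k
    rw [h1, h2] at hdet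
    set j := g 1 1 * C.a (k + 1) - g 0 1 * C.b (k + 1) with hj
    have e1 : g 0 1 = j * C.a k - C.a (k + 1) := by
      rw [hj]; linear_combination -g 0 1 * hk - C.a (k + 1) * hdet
    have e2 : g 1 1 = j * C.b k - C.b (k + 1) := by
      rw [hj]; linear_combination -g 1 1 * hk - C.b (k + 1) * hdet
    rw [e1, e2, isVertex_sub_iff] at h3
    refine ⟨k, j, h3.1, h3.2, Subtype.ext ?_⟩
    rw [corner_mul_T_zpow]
    rw [← e1, ← e2, ← h1, ← h2]
    exact Matrix.eta_fin_two _
  · rintro ⟨k, j, h0, h1, rfl⟩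
    rw [IsEdge, corner_mul_T_zpow]
    exact ⟨C.isVertex k, (C.isVertex_sub_iff k j).2 ⟨h0, h1⟩⟩

lemma isInner_corner_iff (k j : ℤ) :
    C.IsInner (C.corner k * ModularGroup.T ^ j) ↔ 0 ≤ j ∧ j < C.fan k := by
  rw [IsInner, IsEdge, corner_mul_T_zpow]
  have h1 := C.isVertex_sub_iff k j
  have h2 := C.isVertex_sub_iff k (j + 1)
  have e1 : (j + 1) * C.a k - C.a (k + 1) = C.a k + (j * C.a k - C.a (k + 1)) := by ring
  have e2 : (j + 1) * C.b k - C.b (k + 1) = C.b k + (j * C.b k - C.b (k + 1)) := by ring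
  rw [e1, e2] at h2
  have h3 := C.isVertex k
  simp only [Matrix.of_apply, Matrix.cons_val', Matrix.cons_val_zero, Matrix.cons_val_one,
    Matrix.cons_val_fin_one]
  rw [h1, h2]
  constructor
  · rintro ⟨⟨-, h4, h5⟩, h6, h7⟩; omega
  · rintro ⟨h4, h5⟩; exact ⟨⟨h3, h4, h5.le⟩, by omega, by omega⟩

lemma isInner_iff (g : SL(2, ℤ)) :
    C.IsInner g ↔ ∃ k j : ℤ, 0 ≤ j ∧ j < C.fan k ∧ g = C.corner k * ModularGroup.T ^ j := by
  constructor
  · intro h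
    obtain ⟨k, j, h0, h1, rfl⟩ := (C.isEdge_iff g).1 h.1
    exact ⟨k, j, h0, ((C.isInner_corner_iff k j).1 h).2, rfl⟩
  · rintro ⟨k, j, h0, h1, rfl⟩
    exact (C.isInner_corner_iff k j).2 ⟨h0, h1⟩

variable {C} in
lemma IsEdge.isInner_or {g : SL(2, ℤ)} (h : C.IsEdge g) : C.IsInner g ∨ ∃ k, g = C.edge k := by
  obtain ⟨k, j, h0, h1, rfl⟩ := (C.isEdge_iff g).1 h
  rcases h1.lt_or_eq with h1 | rfl
  · exact Or.inl ((C.isInner_corner_iff k j).2 ⟨h0, h1⟩)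
  · exact Or.inr ⟨k - 1, C.corner_mul_T_fan k⟩

variable {C} in
lemma IsEdge.mul_S {g : SL(2, ℤ)} (h : C.IsEdge g) : C.IsEdge (g * ModularGroup.S) := by
  have h1 := h.1.neg
  have h2 := h.2
  rw [IsEdge, Matrix.SpecialLinearGroup.coe_mul, ModularGroup.coe_S]
  simpa [Matrix.mul_apply] using ⟨h2, h1⟩

variable {C} in
lemma IsInner.mul_TS {g : SL(2, ℤ)} (h : C.IsInner g) :
    C.IsInner (g * (ModularGroup.T * ModularGroup.S)) := by
  have h1 := h.1.1.neg
  have h2 := h.1.2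
  have h3 := h.2
  have e : (↑(ModularGroup.T * ModularGroup.S) : Matrix (Fin 2) (Fin 2) ℤ) = !![1, -1; 1, 0] := by
    decide
  rw [IsInner, IsEdge, Matrix.SpecialLinearGroup.coe_mul, e]
  simpa [Matrix.mul_apply] using ⟨⟨h3, h1⟩, h2⟩

variable {C} in
lemma IsInner.neg {g : SL(2, ℤ)} (h : C.IsInner g) : C.IsInner (-g) := by
  have h1 := h.1.1.neg
  have h2 := h.1.2.neg
  have h3 := h.2.neg
  rw [IsInner, IsEdge]
  rw [neg_add, neg_add] at h3
  simpa using ⟨⟨h1, h2⟩, h3⟩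

lemma isEdge_edge (k : ℤ) : C.IsEdge (C.edge k) := ⟨C.isVertex _, C.isVertex _⟩

lemma not_isInner_edge (k : ℤ) : ¬ C.IsInner (C.edge k) := by
  have h := C.corner_mul_T_fan (k + 1)
  rw [add_sub_cancel_right] at h
  rw [← h, isInner_corner_iff]
  omega

/-- The classes of the elements that take `0`, `1` and `∞` to vertices. -/
def inner : Set PSL(2, ℤ) := {g | ∃ h, C.IsInner h ∧ g = QuotientGroup.mk h}

lemma mk_mem_inner_iff (g : SL(2, ℤ)) :
    (QuotientGroup.mk g : PSL(2, ℤ)) ∈ C.inner ↔ C.IsInner g := by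
  constructor
  · rintro ⟨h, hh, h1⟩
    rcases (psl_mk_eq_iff _ _).1 h1 with rfl | rfl
    · exact hh
    · simpa using hh.neg
  · exact fun h => ⟨g, h, rfl⟩

/-- The class of an edge. -/
def pslEdge (k : Fin (n + 2)) : PSL(2, ℤ) := QuotientGroup.mk (C.edge (k : ℕ))

lemma mk_edge_mem_range (k : ℤ) :
    (QuotientGroup.mk (C.edge k) : PSL(2, ℤ)) ∈ Set.range C.pslEdge := by
  obtain ⟨m, c, rfl⟩ := exists_fin (n := n) k
  exact ⟨m, (C.mk_edge_add _ c).symm⟩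

lemma mk_mem_of_isEdge {g : SL(2, ℤ)} (h : C.IsEdge g) :
    (QuotientGroup.mk g : PSL(2, ℤ)) ∈ C.inner ∪ Set.range C.pslEdge := by
  rcases h.isInner_or with h | ⟨k, rfl⟩
  · exact Or.inl ((C.mk_mem_inner_iff g).2 h)
  · exact Or.inr (C.mk_edge_mem_range k)

/-- Equal classes would have parallel source vectors, but sources of distinct edges have positive
determinant. -/
lemma pslEdge_injective : Function.Injective C.pslEdge := by
  have key : ∀ k m : Fin (n + 2), k < m → C.pslEdge k ≠ C.pslEdge m := by
    intro k m hkm h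
    have hpos := C.det_pos (k : ℕ) (m : ℕ) (by simpa using hkm) (by omega)
    have h1 : C.edge (m : ℕ) 0 1 = C.a (m : ℕ) := rfl
    have h2 : C.edge (m : ℕ) 1 1 = C.b (m : ℕ) := rfl
    have h3 : C.edge (k : ℕ) 0 1 = C.a (k : ℕ) := rfl
    have h4 : C.edge (k : ℕ) 1 1 = C.b (k : ℕ) := rfl
    rcases (psl_mk_eq_iff _ _).1 h with h | h
    · rw [← h1, ← h2, h, h3, h4] at hpos
      linarith
    · rw [← h1, ← h2, h] at hpos
      simp only [Matrix.SpecialLinearGroup.coe_neg, Matrix.neg_apply] at hpos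
      rw [h3, h4] at hpos
      linarith
  intro k m h
  rcases lt_trichotomy k m with h' | h' | h'
  · exact absurd h (key k m h')
  · exact h'
  · exact absurd h.symm (key m k h')

end FareyCycle

/-! ### Tiles around the vertices and their connectedness -/

namespace FareyCycle

variable {n : ℕ} (C : FareyCycle n)

/-- The class of a corner, turned `j` times. -/
def pslCorner (k j : ℤ) : PSL(2, ℤ) := QuotientGroup.mk (C.corner k * ModularGroup.T ^ j)

/-- Since T = US, one turn about a vertex is a rotation inside a triangle followed by a crossing. -/
lemma pslCorner_succ (k j : ℤ) : C.pslCorner k (j + 1) = C.pslCorner k j * pslU * pslS := by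
  rw [pslCorner, zpow_add_one, ← mul_assoc, QuotientGroup.mk_mul, mk_T_eq, ← mul_assoc]
  rfl

lemma pslCorner_fan (k : ℤ) :
    C.pslCorner k (C.fan k) = QuotientGroup.mk (C.edge (k - 1)) := by
  rw [pslCorner, corner_mul_T_fan]

lemma pslCorner_fan_mul_S (k : ℤ) :
    C.pslCorner (k + 1) (C.fan (k + 1)) * pslS = C.pslCorner k 0 := by
  rw [pslCorner_fan, pslS, ← QuotientGroup.mk_mul, edge_mul_S, add_sub_cancel_right, pslCorner,
    zpow_zero, mul_one]

lemma pslCorner_add (k c j : ℤ) : C.pslCorner (k + c * (n + 2)) j = C.pslCorner k j := by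
  rw [pslCorner, pslCorner, QuotientGroup.mk_mul, QuotientGroup.mk_mul, mk_corner_add]

lemma pslCorner_mem_inner_iff (k j : ℤ) : C.pslCorner k j ∈ C.inner ↔ 0 ≤ j ∧ j < C.fan k := by
  rw [pslCorner, mk_mem_inner_iff, isInner_corner_iff]

lemma mem_inner_iff (g : PSL(2, ℤ)) :
    g ∈ C.inner ↔ ∃ k j : ℤ, 0 ≤ j ∧ j < C.fan k ∧ g = C.pslCorner k j := by
  constructor
  · rintro ⟨h, hh, rfl⟩
    obtain ⟨k, j, h0, h1, rfl⟩ := (C.isInner_iff h).1 hh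
    exact ⟨k, j, h0, h1, rfl⟩
  · rintro ⟨k, j, h0, h1, rfl⟩
    exact (C.pslCorner_mem_inner_iff k j).2 ⟨h0, h1⟩

lemma mul_pslU_mem_inner {g : PSL(2, ℤ)} (hg : g ∈ C.inner) : g * pslU ∈ C.inner := by
  obtain ⟨h, hh, rfl⟩ := hg
  exact ⟨_, hh.mul_TS, rfl⟩

lemma mul_pslS_mem_of_inner {g : PSL(2, ℤ)} (hg : g ∈ C.inner) :
    g * pslS ∈ C.inner ∪ Set.range C.pslEdge := by
  obtain ⟨h, hh, rfl⟩ := hg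
  exact C.mk_mem_of_isEdge hh.1.mul_S

lemma pslEdge_mul_pslS (k : Fin (n + 2)) : C.pslEdge k * pslS = C.pslCorner (k : ℕ) 0 := by
  rw [pslEdge, pslS, ← QuotientGroup.mk_mul, edge_mul_S, pslCorner, zpow_zero, mul_one]

lemma pslEdge_mul_pslS_mem (k : Fin (n + 2)) :
    C.pslEdge k * pslS ∈ C.inner ∪ Set.range C.pslEdge :=
  C.mk_mem_of_isEdge (C.isEdge_edge k).mul_S

lemma pslEdge_not_mem (k : Fin (n + 2)) : C.pslEdge k ∉ C.inner := by
  rw [pslEdge, mk_mem_inner_iff]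
  exact C.not_isInner_edge _

/-- The tiles of a polygon: the inner ones, and those that are cut by the odd sides. -/
def tiles (odd : Fin (n + 2) → Prop) : Set PSL(2, ℤ) := C.inner ∪ C.pslEdge '' {k | odd k}

lemma exists_corner_of_mem_tiles {odd : Fin (n + 2) → Prop} {g : PSL(2, ℤ)}
    (hg : g ∈ C.tiles odd) : ∃ k j : ℤ, 0 ≤ j ∧ j ≤ C.fan k ∧ g = C.pslCorner k j := by
  rcases hg with hg | ⟨k, -, rfl⟩
  · obtain ⟨k, j, h0, h1, rfl⟩ := (C.mem_inner_iff g).1 hg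
    exact ⟨k, j, h0, h1.le, rfl⟩
  · refine ⟨(k : ℕ) + 1, _, C.fan_nonneg _, le_rfl, ?_⟩
    rw [pslCorner_fan, add_sub_cancel_right, pslEdge]

/-- Turn about each vertex through its fan; the last inner tile at vertex k + 1, rotated by U, is
the first one at vertex k. Without triangles (n = 0) there are at most two tiles, exchanged by S. -/
lemma tiles_connected {odd : Fin (n + 2) → Prop} (r : PSL(2, ℤ) → PSL(2, ℤ) → Prop)
    (hr : Equivalence r)
    (hS : ∀ p ∈ C.tiles odd, p * pslS ∈ C.tiles odd → r p (p * pslS))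
    (hU : ∀ p ∈ C.inner, r p (p * pslU)) (p : PSL(2, ℤ)) (hp : p ∈ C.tiles odd)
    (q : PSL(2, ℤ)) (hq : q ∈ C.tiles odd) : r p q := by
  have hSS : ∀ g, g * pslS * pslS = g := fun g => by rw [mul_assoc, pslS_mul_self, mul_one]
  rcases Nat.eq_zero_or_pos n with hn | hn
  · have hstep : ∀ k, C.pslCorner (k + 1) 0 * pslS = C.pslCorner k 0 := fun k => by
      rw [← C.pslCorner_fan_mul_S k, C.fan_eq_zero hn]
    have htwo : ∀ k, C.pslCorner k 0 = C.pslCorner 0 0 ∨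
        C.pslCorner k 0 = C.pslCorner 0 0 * pslS := by
      intro k
      induction k using Int.induction_on with
      | zero => exact Or.inl rfl
      | succ k ih =>
        rw [← hstep k] at ih
        rcases ih with h | h
        · exact Or.inr (by rw [← h, hSS])
        · exact Or.inl (mul_right_cancel h)
      | pred k ih =>
        rw [← hstep (-k - 1), sub_add_cancel]
        rcases ih with h | h
        · exact Or.inr (by rw [h])
        · exact Or.inl (by rw [h, hSS])
    have hpq : ∀ g ∈ C.tiles odd, g = C.pslCorner 0 0 ∨ g = C.pslCorner 0 0 * pslS := by
      intro g hg
      obtain ⟨k, j, h0, h1, rfl⟩ := C.exists_corner_of_mem_tiles hg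
      rw [C.fan_eq_zero hn] at h1
      rw [le_antisymm h1 h0]
      exact htwo k
    have : q = p ∨ q = p * pslS := by
      rcases hpq p hp with h | h <;> rcases hpq q hq with h' | h' <;> rw [h, h']
      · exact Or.inl rfl
      · exact Or.inr rfl
      · exact Or.inr (hSS _).symm
      · exact Or.inl rfl
    rcases this with rfl | rfl
    · exact hr.refl _
    · exact hS p hp hq
  · have hfan := C.fan_pos hn
    have hin : ∀ k j, 0 ≤ j → j < C.fan k → C.pslCorner k j ∈ C.inner := fun k j h0 h1 =>
      (C.pslCorner_mem_inner_iff k j).2 ⟨h0, h1⟩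
    have h1 : ∀ k j : ℤ, 0 ≤ j → j ≤ C.fan k → C.pslCorner k j ∈ C.tiles odd →
        r (C.pslCorner k 0) (C.pslCorner k j) := by
      intro k j hj
      induction j, hj using Int.leInduction with
      | base => exact fun _ _ => hr.refl _
      | succ j hj ih =>
        intro hle hmem
        have hj' := hin k j hj (by omega)
        refine hr.trans (ih (by omega) (Or.inl hj')) (hr.trans (hU _ hj') ?_)
        rw [pslCorner_succ] at hmem ⊢
        exact hS _ (Or.inl (C.mul_pslU_mem_inner hj')) hmem
    have h2 : ∀ k, r (C.pslCorner k 0) (C.pslCorner (k + 1) 0) := by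
      intro k
      have hf := hfan (k + 1)
      have hj' := hin (k + 1) (C.fan (k + 1) - 1) (by omega) (by omega)
      refine hr.symm (hr.trans (h1 _ _ (by omega) (by omega) (Or.inl hj')) ?_)
      have := C.pslCorner_succ (k + 1) (C.fan (k + 1) - 1)
      rw [sub_add_cancel] at this
      rw [← pslCorner_fan_mul_S, this, hSS]
      exact hU _ hj'
    have h3 : ∀ k, r (C.pslCorner 0 0) (C.pslCorner k 0) := by
      intro k
      induction k using Int.induction_on with
      | zero => exact hr.refl _
      | succ k ih => exact hr.trans ih (h2 k)
      | pred k ih =>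
        refine hr.trans ih (hr.symm ?_)
        simpa using h2 (-k - 1)
    have h4 : ∀ g ∈ C.tiles odd, r (C.pslCorner 0 0) g := by
      intro g hg
      obtain ⟨k, j, hj0, hj1, rfl⟩ := C.exists_corner_of_mem_tiles hg
      exact hr.trans (h3 k) (h1 k j hj0 hj1 hg)
    exact hr.trans (hr.symm (h4 p hp)) (h4 q hq)

/-- The two boundary pieces of a polygon with two vertices are the same Farey edge in opposite
directions. -/
lemma pslEdge_mul_pslS_of_ne (hn : n = 0) {k m : Fin (n + 2)} (hkm : k ≠ m) :
    C.pslEdge k * pslS = C.pslEdge m := by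
  have hval : (k : ℕ) ≠ m := fun h => hkm (Fin.ext h)
  have h2 := C.pslCorner_fan (k : ℕ)
  rw [C.fan_eq_zero hn] at h2
  rw [pslEdge_mul_pslS, h2, pslEdge]
  rcases (by omega : (k : ℕ) = 1 ∧ (m : ℕ) = 0 ∨ (k : ℕ) = 0 ∧ (m : ℕ) = 1) with
    ⟨h3, h4⟩ | ⟨h3, h4⟩
  · rw [h3, h4]; rfl
  · rw [h3, h4, ← C.mk_edge_add _ 1]; congr 2; omega

lemma pslEdge_mul_pslS_mem_tiles {odd : Fin (n + 2) → Prop} (hodd : n = 0 → ∃ k, odd k)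
    (k : Fin (n + 2)) (hk : ¬ odd k) : C.pslEdge k * pslS ∈ C.tiles odd := by
  rcases Nat.eq_zero_or_pos n with hn | hn
  · obtain ⟨m, hm⟩ := hodd hn
    rw [C.pslEdge_mul_pslS_of_ne hn (fun h : k = m => hk (h ▸ hm))]
    exact Or.inr ⟨m, hm, rfl⟩
  · left
    rw [pslEdge_mul_pslS, pslCorner_mem_inner_iff]
    exact ⟨le_rfl, C.fan_pos hn _⟩

lemma tiles_nonempty {odd : Fin (n + 2) → Prop} (hodd : n = 0 → ∃ k, odd k) :
    (C.tiles odd).Nonempty := by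
  by_cases h : odd 0
  · exact ⟨_, Or.inr ⟨0, h, rfl⟩⟩
  · exact ⟨_, C.pslEdge_mul_pslS_mem_tiles hodd 0 h⟩

theorem isComplement_inv_tiles {odd : Fin (n + 2) → Prop} (hodd : n = 0 → ∃ k, odd k)
    (partner : Fin (n + 2) → Fin (n + 2)) (hpp : ∀ k, partner (partner k) = k)
    (hpo : ∀ k, ¬ odd k → ¬ odd (partner k)) :
    Subgroup.IsComplement (C.tiles odd)⁻¹ (Subgroup.closure
      {γ | ∃ k, (¬ odd k ∧ γ = C.pslEdge (partner k) * pslS * (C.pslEdge k)⁻¹) ∨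
        (odd k ∧ γ = C.pslEdge k * pslU * (C.pslEdge k)⁻¹)} : Set PSL(2, ℤ)) :=
  _root_.isComplement_inv_tiles C.inner C.pslEdge odd partner hpp hpo C.pslEdge_injective
    (fun _ => C.mul_pslU_mem_inner) (fun _ => C.mul_pslS_mem_of_inner) C.pslEdge_mul_pslS_mem
    C.pslEdge_not_mem _ rfl (C.tiles_nonempty hodd) (C.pslEdge_mul_pslS_mem_tiles hodd)
    C.tiles_connected

/-- The tiles, listed vertex by vertex. -/
lemma mem_tiles_iff (odd : Fin (n + 2) → Prop) (g : PSL(2, ℤ)) :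
    g ∈ C.tiles odd ↔ ∃ k : Fin (n + 2), ∃ j : ℕ,
      ((j : ℤ) < C.fan (k : ℕ) ∨ ((j : ℤ) = C.fan (k : ℕ) ∧ odd (k - 1))) ∧
        g = C.pslCorner (k : ℕ) j := by
  -- The j = fan tile at vertex k belongs to the piece before it, whence the index k - 1, which
  -- wraps around at 0.
  have hpred : ∀ k : Fin (n + 2), C.pslCorner (k : ℕ) (C.fan (k : ℕ)) = C.pslEdge (k - 1) := by
    intro k
    rw [pslCorner_fan, pslEdge]
    rcases Fin.eq_zero_or_eq_succ k with rfl | ⟨i, rfl⟩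
    · rw [← C.mk_edge_add _ 1]
      congr 2
      simp [Fin.val_neg]
      ring
    · have h : (i.succ - 1 : Fin (n + 2)) = i.castSucc := by
        rw [sub_eq_iff_eq_add, Fin.coeSucc_eq_succ]
      rw [h]
      congr 2
      simp
  constructor
  · rintro (hg | ⟨k, hk, rfl⟩)
    · obtain ⟨k, j, h0, h1, rfl⟩ := (C.mem_inner_iff g).1 hg
      obtain ⟨m, c, rfl⟩ := exists_fin (n := n) k
      rw [fan_add] at h1
      obtain ⟨i, rfl⟩ := Int.eq_ofNat_of_zero_le h0
      exact ⟨m, i, Or.inl h1, C.pslCorner_add _ _ _⟩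
    · obtain ⟨i, hi⟩ := Int.eq_ofNat_of_zero_le (C.fan_nonneg ((k + 1 : Fin (n + 2)) : ℕ))
      have h := hpred (k + 1)
      rw [add_sub_cancel_right] at h
      exact ⟨k + 1, i, Or.inr ⟨hi.symm, by rwa [add_sub_cancel_right]⟩, by rw [← hi, h]⟩
  · rintro ⟨k, j, h | ⟨h, hk⟩, rfl⟩
    · exact Or.inl ((C.pslCorner_mem_inner_iff _ _).2 ⟨by positivity, h⟩)
    · rw [h, hpred]
      exact Or.inr ⟨_, hk, rfl⟩

end FareyCycle

/-! ### Recognising modular transformations by the images of points -/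

lemma cuspMove_mul (g h : SL(2, ℤ)) (c : OnePoint ℚ) :
    cuspMove (g * h) c = cuspMove g (cuspMove h c) := by
  simp [cuspMove, mul_smul]

lemma cuspMove_one (c : OnePoint ℚ) : cuspMove 1 c = c := by
  simp [cuspMove]

lemma cuspMove_S_zero : cuspMove ModularGroup.S ((0 : ℚ) : OnePoint ℚ) = ∞ := by
  rw [cuspMove_zero]; simp [ModularGroup.S]

lemma cuspMove_S_infty : cuspMove ModularGroup.S ∞ = ((0 : ℚ) : OnePoint ℚ) := by
  rw [cuspMove_infty]; simp [ModularGroup.S]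

lemma cuspMove_TS_zero :
    cuspMove (ModularGroup.T * ModularGroup.S) ((0 : ℚ) : OnePoint ℚ) = ∞ := by
  rw [cuspMove_mul, cuspMove_S_zero, cuspMove_infty]
  simp [ModularGroup.T]

lemma mk_eq_one_of_cuspMove {g : SL(2, ℤ)}
    (h0 : cuspMove g ((0 : ℚ) : OnePoint ℚ) = ((0 : ℚ) : OnePoint ℚ)) (h1 : cuspMove g ∞ = ∞) :
    (QuotientGroup.mk g : PSL(2, ℤ)) = 1 := by
  rw [cuspMove_zero] at h0
  rw [cuspMove_infty] at h1
  have hdet : g 0 0 * g 1 1 - g 0 1 * g 1 0 = 1 := by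
    have := g.det_coe
    rwa [Matrix.det_fin_two] at this
  have h10 : g 1 0 = 0 := by by_contra h; simp [h] at h1
  have h11 : g 1 1 ≠ 0 := by intro h; simp [h] at h0
  have h01 : g 0 1 = 0 := by simpa [h11] using h0
  rw [h01, h10] at hdet
  rw [← QuotientGroup.mk_one, psl_mk_eq_iff]
  rcases Int.isUnit_iff.1 (IsUnit.of_mul_eq_one (g 1 1) (by linarith : g 0 0 * g 1 1 = 1)) with h00 | h00 <;>
    rw [h00] at hdet
  · left
    apply Subtype.ext
    rw [Matrix.eta_fin_two (g : Matrix (Fin 2) (Fin 2) ℤ), h00, h01, h10,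
      show g 1 1 = 1 by linarith]
    exact Matrix.one_fin_two
  · right
    apply Subtype.ext
    rw [Matrix.SpecialLinearGroup.coe_neg, Matrix.eta_fin_two (g : Matrix (Fin 2) (Fin 2) ℤ),
      h00, h01, h10, show g 1 1 = -1 by linarith]
    simp [Matrix.one_fin_two]

lemma cuspMove_inv_eq {g : SL(2, ℤ)} {c d : OnePoint ℚ} (h : cuspMove g c = d) :
    cuspMove g⁻¹ d = c := by
  rw [← h, ← cuspMove_mul, inv_mul_cancel, cuspMove_one]

/-- An element of `PSL(2, ℤ)` is determined by the images of `0` and `∞`. -/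
lemma mk_eq_mk_of_cuspMove {g h : SL(2, ℤ)}
    (h0 : cuspMove g ((0 : ℚ) : OnePoint ℚ) = cuspMove h ((0 : ℚ) : OnePoint ℚ))
    (h1 : cuspMove g ∞ = cuspMove h ∞) :
    (QuotientGroup.mk g : PSL(2, ℤ)) = QuotientGroup.mk h := by
  have := mk_eq_one_of_cuspMove (g := g⁻¹ * h)
    (by rw [cuspMove_mul, ← h0, ← cuspMove_mul, inv_mul_cancel, cuspMove_one])
    (by rw [cuspMove_mul, ← h1, ← cuspMove_mul, inv_mul_cancel, cuspMove_one])
  rw [QuotientGroup.mk_mul, QuotientGroup.mk_inv, inv_mul_eq_one] at this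
  exact this

/-- The elements that take `0` to `∞`. -/
lemma exists_T_zpow_mul_S {g : SL(2, ℤ)} (h0 : cuspMove g ((0 : ℚ) : OnePoint ℚ) = ∞) :
    ∃ p : ℤ, g = ModularGroup.T ^ p * ModularGroup.S ∨
      g = -(ModularGroup.T ^ p * ModularGroup.S) := by
  rw [cuspMove_zero] at h0
  have hdet : g 0 0 * g 1 1 - g 0 1 * g 1 0 = 1 := by
    have := g.det_coe
    rwa [Matrix.det_fin_two] at this
  have h11 : g 1 1 = 0 := by by_contra h; simp [h] at h0
  rw [h11] at hdet
  have key : ∀ p : ℤ, (↑(ModularGroup.T ^ p * ModularGroup.S) : Matrix (Fin 2) (Fin 2) ℤ) =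
      !![p, -1; 1, 0] := by
    intro p
    rw [Matrix.SpecialLinearGroup.coe_mul, ModularGroup.coe_T_zpow, ModularGroup.coe_S,
      Matrix.mul_fin_two]
    simp
  rcases Int.isUnit_iff.1 (IsUnit.of_mul_eq_one (-g 0 1) (by linarith : g 1 0 * -g 0 1 = 1))
    with h10 | h10 <;> rw [h10] at hdet
  · refine ⟨g 0 0, Or.inl (Subtype.ext ?_)⟩
    rw [key, Matrix.eta_fin_two (g : Matrix (Fin 2) (Fin 2) ℤ), h10, h11,
      show g 0 1 = -1 by linarith]
    rfl
  · refine ⟨-g 0 0, Or.inr (Subtype.ext ?_)⟩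
    rw [Matrix.SpecialLinearGroup.coe_neg, key, Matrix.eta_fin_two (g : Matrix (Fin 2) (Fin 2) ℤ),
      h10, h11, show g 0 1 = 1 by linarith]
    simp

lemma S_smul_I : ModularGroup.S • UpperHalfPlane.I = UpperHalfPlane.I := by
  rw [UpperHalfPlane.modular_S_smul]
  ext1
  simp

lemma rhoPoint_re : rhoPoint.re = 1 / 2 := rfl

lemma rhoPoint_im : rhoPoint.im = Real.sqrt 3 / 2 := rfl

lemma normSq_rhoPoint : Complex.normSq (rhoPoint : ℂ) = 1 := by
  rw [Complex.normSq_apply, UpperHalfPlane.coe_re, UpperHalfPlane.coe_im, rhoPoint_re, rhoPoint_im]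
  have : Real.sqrt 3 * Real.sqrt 3 = 3 := Real.mul_self_sqrt (by norm_num)
  linarith

lemma TS_smul_rhoPoint : (ModularGroup.T * ModularGroup.S) • rhoPoint = rhoPoint := by
  have h1 : ((ModularGroup.T * ModularGroup.S) • rhoPoint).re = rhoPoint.re := by
    rw [mul_smul, UpperHalfPlane.modular_T_smul, UpperHalfPlane.vadd_re, ModularGroup.re_S_smul,
      normSq_rhoPoint, rhoPoint_re]
    norm_num
  have h2 : ((ModularGroup.T * ModularGroup.S) • rhoPoint).im = rhoPoint.im := by
    rw [mul_smul, UpperHalfPlane.modular_T_smul, UpperHalfPlane.vadd_im,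
      UpperHalfPlane.modular_S_smul, UpperHalfPlane.mk_im, Complex.inv_im]
    simp [normSq_rhoPoint]
  exact UpperHalfPlane.ext (Complex.ext h1 h2)

lemma re_T_zpow_mul_S_smul (p : ℤ) (z : UpperHalfPlane) :
    ((ModularGroup.T ^ p * ModularGroup.S) • z).re = p - z.re / Complex.normSq z := by
  rw [mul_smul, UpperHalfPlane.modular_T_zpow_smul, UpperHalfPlane.vadd_re, ModularGroup.re_S_smul]
  ring

/-- Elements taking 0 to ∞ are T^p S up to sign; fixing i forces p = 0 by comparing real parts. -/
lemma mk_eq_pslS {g : SL(2, ℤ)} (h0 : cuspMove g ((0 : ℚ) : OnePoint ℚ) = ∞)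
    (h1 : g • UpperHalfPlane.I = UpperHalfPlane.I) : (QuotientGroup.mk g : PSL(2, ℤ)) = pslS := by
  obtain ⟨p, hp⟩ := exists_T_zpow_mul_S h0
  have h2 : (ModularGroup.T ^ p * ModularGroup.S) • UpperHalfPlane.I = UpperHalfPlane.I := by
    rcases hp with rfl | rfl
    · exact h1
    · rwa [ModularGroup.SL_neg_smul] at h1
  have h3 := congrArg UpperHalfPlane.re h2
  rw [re_T_zpow_mul_S_smul, UpperHalfPlane.I_re] at h3
  have h4 : p = 0 := by
    have : (p : ℝ) = 0 := by simpa using h3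
    exact_mod_cast this
  rw [h4, zpow_zero, one_mul] at hp
  rcases hp with rfl | rfl
  · rfl
  · exact psl_mk_neg _

lemma mk_eq_pslU {g : SL(2, ℤ)} (h0 : cuspMove g ((0 : ℚ) : OnePoint ℚ) = ∞)
    (h1 : g • rhoPoint = rhoPoint) : (QuotientGroup.mk g : PSL(2, ℤ)) = pslU := by
  obtain ⟨p, hp⟩ := exists_T_zpow_mul_S h0
  have h2 : (ModularGroup.T ^ p * ModularGroup.S) • rhoPoint = rhoPoint := by
    rcases hp with rfl | rfl
    · exact h1
    · rwa [ModularGroup.SL_neg_smul] at h1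
  have h3 := congrArg UpperHalfPlane.re h2
  rw [re_T_zpow_mul_S_smul, normSq_rhoPoint, rhoPoint_re] at h3
  have h4 : p = 1 := by
    have : (p : ℝ) = 1 := by linarith
    exact_mod_cast this
  rw [h4, zpow_one] at hp
  rcases hp with rfl | rfl
  · rfl
  · exact psl_mk_neg _

/-- A line in the upper half-plane has empty interior. -/
lemma interior_re_inv_smul_eq_zero (g : SL(2, ℤ)) :
    interior {z : UpperHalfPlane | (g⁻¹ • z).re = 0} = ∅ := by
  by_contra h
  obtain ⟨z, hz⟩ := Set.nonempty_iff_ne_empty.2 h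
  -- A curve through z transverse to the line: horizontal translation in the coordinate where the
  -- line is the imaginary axis.
  let F : ℝ → UpperHalfPlane := fun t => g • (t +ᵥ g⁻¹ • z)
  have hF : Continuous F := by
    refine (continuous_const_smul (Matrix.SpecialLinearGroup.mapGL ℝ g)).comp
      (g := fun z : UpperHalfPlane => Matrix.SpecialLinearGroup.mapGL ℝ g • z) ?_
    rw [UpperHalfPlane.isEmbedding_coe.continuous_iff]
    change Continuous fun t : ℝ => (t : ℂ) + ((g⁻¹ • z : UpperHalfPlane) : ℂ)
    fun_prop
  have hF0 : F 0 = z := by simp [F]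
  have h1 : F ⁻¹' interior {z : UpperHalfPlane | (g⁻¹ • z).re = 0} ∈ nhds (0 : ℝ) :=
    hF.continuousAt.preimage_mem_nhds (hF0.symm ▸ isOpen_interior.mem_nhds hz)
  obtain ⟨ε, hε, hball⟩ := Metric.mem_nhds_iff.1 h1
  have h2 : ∀ t ∈ Metric.ball (0 : ℝ) ε, t + (g⁻¹ • z).re = 0 := by
    intro t ht
    have : F t ∈ {z : UpperHalfPlane | (g⁻¹ • z).re = 0} := interior_subset (hball ht)
    replace this : (g⁻¹ • F t).re = 0 := this
    rwa [inv_smul_smul, UpperHalfPlane.vadd_re] at this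
  have h3 := h2 0 (Metric.mem_ball_self hε)
  have h4 := h2 (ε / 2) (by rw [Metric.mem_ball, Real.dist_eq, sub_zero, abs_of_pos] <;> linarith)
  linarith

/-! ### Antiperiodic extension of the vertex sequence -/

/-- The extension of a sequence of length `n + 2` to `ℤ` that changes sign after one turn. -/
def antiperiodic {n : ℕ} (A : Fin (n + 3) → ℤ) (k : ℤ) : ℤ :=
  (k / (n + 2)).negOnePow * A (Fin.castSucc ⟨(k % (n + 2)).toNat, by
    have h0 : (0 : ℤ) < n + 2 := by positivity
    have h1 := Int.emod_nonneg k h0.ne'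
    have h2 := Int.emod_lt_of_pos k h0
    omega⟩)

section antiperiodic

variable {n : ℕ} (A : Fin (n + 3) → ℤ)

lemma antiperiodic_apply (i : Fin (n + 2)) (c : ℤ) :
    antiperiodic A ((i : ℕ) + c * (n + 2)) = c.negOnePow * A i.castSucc := by
  have h0 : (0 : ℤ) < n + 2 := by positivity
  have hi : ((i : ℕ) : ℤ) < n + 2 := by exact_mod_cast i.2
  have h1 : (((i : ℕ) : ℤ) + c * (n + 2)) / (n + 2) = c := by
    rw [Int.add_mul_ediv_right _ _ h0.ne', Int.ediv_eq_zero_of_lt (by positivity) hi, zero_add]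
  have h2 : (((i : ℕ) : ℤ) + c * (n + 2)) % (n + 2) = (i : ℕ) := by
    rw [Int.add_mul_emod_self_right, Int.emod_eq_of_lt (by positivity) hi]
  rw [antiperiodic, h1]
  congr 3
  ext
  simp [h2]

lemma antiperiodic_add (k : ℤ) : antiperiodic A (k + (n + 2)) = -antiperiodic A k := by
  obtain ⟨i, c, rfl⟩ := FareyCycle.exists_fin (n := n) k
  rw [show ((i : ℕ) : ℤ) + c * (n + 2) + (n + 2) = (i : ℕ) + (c + 1) * (n + 2) by ring,
    antiperiodic_apply, antiperiodic_apply, Int.negOnePow_succ]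
  simp

lemma antiperiodic_apply_succ (hA : A (Fin.last _) = -A 0) (i : Fin (n + 2)) (c : ℤ) :
    antiperiodic A ((i : ℕ) + c * (n + 2) + 1) = c.negOnePow * A i.succ := by
  refine Fin.lastCases ?_ (fun j => ?_) i
  · have h := antiperiodic_apply A 0 (c + 1)
    rw [Fin.succ_last, hA]
    rw [Int.negOnePow_succ, Fin.castSucc_zero, Units.val_neg, neg_mul] at h
    rw [mul_neg, ← h]
    congr 1
    simp only [Fin.val_last, Fin.val_zero]
    push_cast
    ring
  · have h := antiperiodic_apply A j.succ c
    rw [← Fin.succ_castSucc] at h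
    rw [← h]
    congr 1
    simp
    ring

lemma antiperiodic_apply_pred (i : Fin (n + 2)) :
    antiperiodic A ((i : ℕ) - 1) = (if i = 0 then -1 else 1) * A (i - 1).castSucc := by
  rcases Fin.eq_zero_or_eq_succ i with rfl | ⟨j, rfl⟩
  -- The index before 0 is the last one of the previous turn, which brings in the sign.
  · have h := antiperiodic_apply A (0 - 1) (-1)
    rw [show (-1 : ℤ).negOnePow = -1 from rfl] at h
    rw [if_pos rfl]
    convert h using 2
    · simp [Fin.val_neg]
      ring
    · rfl
  · have hj : (j.succ - 1 : Fin (n + 2)) = j.castSucc := by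
      rw [sub_eq_iff_eq_add, Fin.coeSucc_eq_succ]
    have h := antiperiodic_apply A j.castSucc 0
    rw [if_neg (Fin.succ_ne_zero j), hj]
    convert h using 2 <;> simp

end antiperiodic

lemma cuspSeq_eq {n : ℕ} (x : Fin (n + 1) → ℚ) (p : Fin (n + 3)) :
    cuspSeq x p = if denSeq x p = 0 then ∞
      else (((numSeq x p : ℚ) / (denSeq x p : ℚ) : ℚ) : OnePoint ℚ) := by
  refine Fin.cases ?_ (fun q => ?_) p
  · simp [cuspSeq, denSeq]
  · refine Fin.lastCases ?_ (fun i => ?_) q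
    · simp [cuspSeq, denSeq]
    · simp [cuspSeq, denSeq, numSeq, Rat.num_div_den]

/-! ### The special polygon as a Farey cycle, and its group -/

namespace SpecialPolygon

variable (P : SpecialPolygon)

lemma a_last : P.a (Fin.last _) = -P.a 0 := by
  rw [← Fin.succ_last]
  simp [a, numSeq]

lemma b_last : P.b (Fin.last _) = -P.b 0 := by
  rw [← Fin.succ_last]
  simp [b, denSeq]

lemma det_pos_of_lt {r m : Fin (P.n + 2)} (h : r < m) :
    0 < P.a m.castSucc * P.b r.castSucc - P.a r.castSucc * P.b m.castSucc := by
  obtain ⟨j, rfl⟩ := Fin.exists_succ_eq.2 (Fin.ne_zero_of_lt h)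
  rw [← Fin.succ_castSucc]
  rcases Fin.eq_zero_or_eq_succ r with rfl | ⟨i, rfl⟩
  · have := (P.x j).den_pos
    simp [a, b, numSeq, denSeq, this]
  · rw [← Fin.succ_castSucc]
    have hij := P.strictMono_x (Fin.succ_lt_succ_iff.1 h)
    rw [Rat.lt_iff] at hij
    simp only [a, b, numSeq, denSeq, Fin.cons_succ, Fin.snoc_castSucc]
    linarith

/-- The vertices of a special polygon as a cycle in the Farey tessellation. -/
def cycle : FareyCycle P.n where
  a := antiperiodic P.a
  b := antiperiodic P.b
  a_add := antiperiodic_add P.a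
  b_add := antiperiodic_add P.b
  det_succ k := by
    obtain ⟨i, c, rfl⟩ := FareyCycle.exists_fin (n := P.n) k
    have h := farey_relation P.strictMono_x i (P.frame i) (P.frame_zero i) (P.frame_infty i)
    change P.a i.succ * P.b i.castSucc - P.a i.castSucc * P.b i.succ = 1 at h
    rw [antiperiodic_apply_succ _ P.a_last, antiperiodic_apply_succ _ P.b_last, antiperiodic_apply,
      antiperiodic_apply]
    rcases Int.even_or_odd c with hc | hc
    · simpa [Int.negOnePow_even c hc] using h
    · simpa [Int.negOnePow_odd c hc] using h
  det_pos k m hkm hmk := by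
    obtain ⟨i, c, rfl⟩ := FareyCycle.exists_fin (n := P.n) k
    obtain ⟨j, d, rfl⟩ := FareyCycle.exists_fin (n := P.n) m
    have hi : ((i : ℕ) : ℤ) < P.n + 2 := by exact_mod_cast i.2
    have hj : ((j : ℕ) : ℤ) < P.n + 2 := by exact_mod_cast j.2
    have hcd : d = c ∨ d = c + 1 := by
      have h1 : c < d + 1 := by
        by_contra! h
        nlinarith
      have h2 : d < c + 2 := by
        by_contra! h
        nlinarith
      omega
    simp only [antiperiodic_apply]
    rcases hcd with rfl | rfl
    · have h := P.det_pos_of_lt (r := i) (m := j) (by rw [Fin.lt_def]; omega)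
      rcases Int.even_or_odd d with hc | hc
      · simpa [Int.negOnePow_even d hc] using h
      · simpa [Int.negOnePow_odd d hc] using h
    -- Here m lies in the next turn: exchanging the two vertices reverses the determinant, and the
    -- antiperiodicity reverses it back.
    · have h := P.det_pos_of_lt (r := j) (m := i) (by
        rw [Fin.lt_def]
        rw [add_mul, one_mul] at hmk
        omega)
      rw [Int.negOnePow_succ]
      rcases Int.even_or_odd c with hc | hc
      · simp only [Int.negOnePow_even c hc]
        push_cast
        linarith
      · simp only [Int.negOnePow_odd c hc]
        push_cast
        linarith

lemma cycle_a (i : Fin (P.n + 2)) : P.cycle.a (i : ℕ) = P.a i.castSucc := by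
  simpa [cycle] using antiperiodic_apply P.a i 0

lemma cycle_b (i : Fin (P.n + 2)) : P.cycle.b (i : ℕ) = P.b i.castSucc := by
  simpa [cycle] using antiperiodic_apply P.b i 0

lemma cycle_a_succ (i : Fin (P.n + 2)) : P.cycle.a ((i : ℕ) + 1) = P.a i.succ := by
  simpa [cycle] using antiperiodic_apply_succ P.a P.a_last i 0

lemma cycle_b_succ (i : Fin (P.n + 2)) : P.cycle.b ((i : ℕ) + 1) = P.b i.succ := by
  simpa [cycle] using antiperiodic_apply_succ P.b P.b_last i 0

lemma cycle_corner (k : Fin (P.n + 2)) : P.cycle.corner (k : ℕ) = P.phi k := by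
  apply Subtype.ext
  simp only [FareyCycle.corner, phi, cycle_a, cycle_b, cycle_a_succ, cycle_b_succ]

lemma natAbs_eq_fan (k : Fin (P.n + 2)) :
    (((P.a (k - 1).castSucc * P.b k.succ - P.a k.succ * P.b (k - 1).castSucc).natAbs : ℕ) : ℤ) =
      P.cycle.fan (k : ℕ) := by
  rw [← abs_of_nonneg (P.cycle.fan_nonneg (k : ℕ)), FareyCycle.fan, cycle_a_succ, cycle_b_succ,
    show P.cycle.a ((k : ℕ) - 1) = _ from antiperiodic_apply_pred P.a k,
    show P.cycle.b ((k : ℕ) - 1) = _ from antiperiodic_apply_pred P.b k, Int.natCast_natAbs]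
  -- The sign from wrapping around at k = 0 disappears in the absolute value.
  split_ifs
  · congr 1; ring
  · rw [abs_sub_comm]; congr 1; ring

lemma lt_width_iff (k : Fin (P.n + 2)) (j : ℕ) :
    j < P.width k ↔ (j : ℤ) < P.cycle.fan (k : ℕ) ∨
      ((j : ℤ) = P.cycle.fan (k : ℕ) ∧ P.kind (k - 1) = .odd) := by
  rw [← natAbs_eq_fan, width]
  rcases h : P.kind (k - 1) with _ | _ | _
  · simp only [reduceCtorEq, and_false, or_false]
    omega
  · simp only [and_true]
    omega
  · simp only [reduceCtorEq, and_false, or_false]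
    omega

lemma cuspMove_edge_zero (k : Fin (P.n + 2)) :
    cuspMove (P.cycle.edge (k : ℕ)) ((0 : ℚ) : OnePoint ℚ) = cuspSeq P.x k.castSucc := by
  rw [cuspMove_zero, cuspSeq_eq]
  change (if P.cycle.b (k : ℕ) = 0 then _ else
    (((P.cycle.a (k : ℕ) : ℚ) / (P.cycle.b (k : ℕ) : ℚ) : ℚ) : OnePoint ℚ)) = _
  rw [cycle_a, cycle_b]
  rfl

lemma cuspMove_edge_infty (k : Fin (P.n + 2)) :
    cuspMove (P.cycle.edge (k : ℕ)) ∞ = cuspSeq P.x k.succ := by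
  rw [cuspMove_infty, cuspSeq_eq]
  change (if P.cycle.b ((k : ℕ) + 1) = 0 then _ else
    (((P.cycle.a ((k : ℕ) + 1) : ℚ) / (P.cycle.b ((k : ℕ) + 1) : ℚ) : ℚ) : OnePoint ℚ)) = _
  rw [cycle_a_succ, cycle_b_succ]
  rfl

lemma pslEdge_eq (k : Fin (P.n + 2)) : P.cycle.pslEdge k = QuotientGroup.mk (P.frame k) :=
  mk_eq_mk_of_cuspMove (by rw [cuspMove_edge_zero, P.frame_zero])
    (by rw [cuspMove_edge_infty, P.frame_infty])

lemma kind_partner {k : Fin (P.n + 2)} (h : P.kind k = .free) : P.kind (P.partner k) = .free := by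
  by_contra hne
  have h1 := (P.partner_eq_self_iff _).2 hne
  rw [P.partner_partner] at h1
  exact (P.partner_eq_self_iff k).1 h1.symm h

lemma kind_partner_ne_odd {k : Fin (P.n + 2)} (h : ¬ P.kind k = .odd) :
    ¬ P.kind (P.partner k) = .odd := by
  by_cases hf : P.kind k = .free
  · rw [P.kind_partner hf]; simp
  · rwa [(P.partner_eq_self_iff k).2 hf]

/-- The group of a special polygon is generated by the conjugates of `pslU` that belong to the odd
sides and by the elements that glue two other sides. -/
lemma group_eq : P.group = Subgroup.closure
    {γ | ∃ k, (¬ P.kind k = .odd ∧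
        γ = P.cycle.pslEdge (P.partner k) * pslS * (P.cycle.pslEdge k)⁻¹) ∨
      (P.kind k = .odd ∧ γ = P.cycle.pslEdge k * pslU * (P.cycle.pslEdge k)⁻¹)} := by
  rw [group]
  congr 1
  ext α
  have hconj : ∀ (k m : Fin (P.n + 2)) (γ : SL(2, ℤ)) (s : PSL(2, ℤ)),
      (QuotientGroup.mk ((P.frame m)⁻¹ * γ * P.frame k) : PSL(2, ℤ)) = s →
        (QuotientGroup.mk γ : PSL(2, ℤ)) = P.cycle.pslEdge m * s * (P.cycle.pslEdge k)⁻¹ := by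
    rintro k m γ _ rfl
    rw [pslEdge_eq, pslEdge_eq, QuotientGroup.mk_mul, QuotientGroup.mk_mul, QuotientGroup.mk_inv]
    group
  have hzero : ∀ (k m : Fin (P.n + 2)) (γ : SL(2, ℤ)),
      (P.initialCusp k).move γ = P.terminalCusp m →
        cuspMove ((P.frame m)⁻¹ * γ * P.frame k) ((0 : ℚ) : OnePoint ℚ) = ∞ := by
    intro k m γ h
    rw [cuspMove_mul, cuspMove_mul, P.frame_zero]
    exact cuspMove_inv_eq ((P.frame_infty m).trans (ExtPoint.ideal.inj h).symm)
  have hinfty : ∀ (k m : Fin (P.n + 2)) (γ : SL(2, ℤ)),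
      (P.terminalCusp k).move γ = P.initialCusp m →
        cuspMove ((P.frame m)⁻¹ * γ * P.frame k) ∞ = ((0 : ℚ) : OnePoint ℚ) := by
    intro k m γ h
    rw [cuspMove_mul, cuspMove_mul, P.frame_infty]
    exact cuspMove_inv_eq ((P.frame_zero m).trans (ExtPoint.ideal.inj h).symm)
  have hinner : ∀ (k : Fin (P.n + 2)) (γ : SL(2, ℤ)) (z : UpperHalfPlane),
      (ExtPoint.inner (P.frame k • z)).move γ = .inner (P.frame k • z) →
        ((P.frame k)⁻¹ * γ * P.frame k) • z = z := by
    intro k γ z h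
    rw [mul_smul, mul_smul, ExtPoint.inner.inj h, inv_smul_smul]
  have hzero' : ∀ (k m : Fin (P.n + 2)) (g : SL(2, ℤ)),
      cuspMove g ((0 : ℚ) : OnePoint ℚ) = ∞ →
        (P.initialCusp k).move (P.frame m * g * (P.frame k)⁻¹) = P.terminalCusp m := by
    intro k m g h
    refine congrArg ExtPoint.ideal ?_
    rw [cuspMove_mul, cuspMove_inv_eq (P.frame_zero k), cuspMove_mul, h, P.frame_infty]
  have hinfty' : ∀ (k m : Fin (P.n + 2)) (g : SL(2, ℤ)),
      cuspMove g ∞ = ((0 : ℚ) : OnePoint ℚ) →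
        (P.terminalCusp k).move (P.frame m * g * (P.frame k)⁻¹) = P.initialCusp m := by
    intro k m g h
    refine congrArg ExtPoint.ideal ?_
    rw [cuspMove_mul, cuspMove_inv_eq (P.frame_infty k), cuspMove_mul, h, P.frame_zero]
  have hinner' : ∀ (k : Fin (P.n + 2)) (g : SL(2, ℤ)) (z : UpperHalfPlane), g • z = z →
      (ExtPoint.inner (P.frame k • z)).move (P.frame k * g * (P.frame k)⁻¹) =
        .inner (P.frame k • z) := by
    intro k g z h
    refine congrArg ExtPoint.inner ?_
    rw [mul_smul, inv_smul_smul, mul_smul, h]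
  have hmk : ∀ (k m : Fin (P.n + 2)) (g : SL(2, ℤ)),
      P.cycle.pslEdge m * QuotientGroup.mk g * (P.cycle.pslEdge k)⁻¹ =
        QuotientGroup.mk (P.frame m * g * (P.frame k)⁻¹) := by
    intro k m g
    rw [pslEdge_eq, pslEdge_eq]
    rfl
  constructor
  · rintro ⟨γ, s, t, hst, ⟨h1, h2⟩, rfl⟩
    cases hst with
    | even k hk =>
      refine ⟨k, Or.inl ⟨by rw [hk]; simp, ?_⟩⟩
      -- An even piece is its own partner, so it obeys the same gluing formula as a free side.
      rw [(P.partner_eq_self_iff k).2 (by rw [hk]; simp)]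
      exact hconj _ _ _ _ (mk_eq_pslS (hzero k k γ h1) (hinner k γ _ h2))
    | odd k hk =>
      exact ⟨k, Or.inr ⟨hk, hconj _ _ _ _ (mk_eq_pslU (hzero k k γ h1) (hinner k γ _ h2))⟩⟩
    | free k hk =>
      refine ⟨k, Or.inl ⟨by rw [hk]; simp, hconj _ _ _ _ ?_⟩⟩
      exact mk_eq_mk_of_cuspMove ((hzero _ _ γ h1).trans cuspMove_S_zero.symm)
        ((hinfty _ _ γ h2).trans cuspMove_S_infty.symm)
  · rintro ⟨k, ⟨hk, rfl⟩ | ⟨hk, rfl⟩⟩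
    · by_cases hf : P.kind k = .free
      · exact ⟨_, _, _, .free k hf, ⟨hzero' k _ _ cuspMove_S_zero, hinfty' k _ _ cuspMove_S_infty⟩,
          hmk _ _ _⟩
      · have he : P.kind k = .even := by
          rcases h : P.kind k with _ | _ | _
          · rfl
          · exact absurd h hk
          · exact absurd h hf
        rw [(P.partner_eq_self_iff k).2 hf]
        exact ⟨_, _, _, .even k he, ⟨hzero' k _ _ cuspMove_S_zero, hinner' k _ _ S_smul_I⟩,
          hmk _ _ _⟩
    · exact ⟨_, _, _, .odd k hk, ⟨hzero' k _ _ cuspMove_TS_zero, hinner' k _ _ TS_smul_rhoPoint⟩,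
        hmk _ _ _⟩

lemma re_nonpos_of_mem_leftPart {p : PairingKind} (hp : p ≠ .odd) {γ : SL(2, ℤ)}
    {z : UpperHalfPlane} (hz : z ∈ leftPart p γ) : (γ⁻¹ • z).re ≤ 0 := by
  cases p with
  | even => exact hz
  | odd => exact absurd rfl hp
  | free => exact hz

/-- A special polygon with two ideal vertices has an odd side. -/
lemma exists_odd (hn : P.n = 0) : ∃ k, P.kind k = .odd := by
  by_contra! hodd
  have h01 : (0 : Fin (P.n + 2)) ≠ 1 := by simp
  have h1 := P.cycle.pslEdge_mul_pslS_of_ne hn h01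
  rw [pslEdge_eq, pslEdge_eq, pslS, ← QuotientGroup.mk_mul, psl_mk_eq_iff] at h1
  -- The two half-planes are opposite sides of one geodesic and meet only in it. Only here does the
  -- nonempty interior enter.
  have hsub : P.region ⊆ {z : UpperHalfPlane | ((P.frame 1)⁻¹ • z).re = 0} := by
    intro z hz
    have hz' := Set.mem_iInter.1 hz
    have e0 := re_nonpos_of_mem_leftPart (hodd 0) (hz' 0)
    have e1 := re_nonpos_of_mem_leftPart (hodd 1) (hz' 1)
    have e2 : (P.frame 0)⁻¹ • z = ModularGroup.S • (P.frame 1)⁻¹ • z := by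
      rw [inv_smul_eq_iff, ← mul_smul]
      rcases h1 with h1 | h1
      · rw [← h1, smul_inv_smul]
      · rw [← ModularGroup.SL_neg_smul, ← h1, smul_inv_smul]
    rw [e2, ModularGroup.re_S_smul_nonpos_iff] at e0
    exact le_antisymm e1 e0
  have h2 := P.interior_nonempty.mono (interior_mono hsub)
  rw [interior_re_inv_smul_eq_zero] at h2
  exact Set.not_nonempty_empty h2

end SpecialPolygon

theorem mainTheorem3 (Γ : Subgroup PSL(2, ℤ)) (P : SpecialPolygon) (hP : P.group = Γ) :
    Subgroup.IsComplement
      (⋃ k : Fin (P.n + 2), {α : PSL(2, ℤ) | ∃ j : ℕ, j < P.width k ∧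
        α = QuotientGroup.mk ((ModularGroup.T ^ j)⁻¹ * (P.phi k)⁻¹)})
      (Γ : Set PSL(2, ℤ)) := by
  have h := P.cycle.isComplement_inv_tiles (odd := fun k => P.kind k = .odd) P.exists_odd P.partner
    P.partner_partner (fun _ => P.kind_partner_ne_odd)
  rw [← P.group_eq, hP] at h
  -- The representatives T^{-j} φ⁻¹ are exactly the inverses of the tiles φ T^j.
  convert h using 1
  ext α
  rw [Set.mem_iUnion, Set.mem_inv, FareyCycle.mem_tiles_iff]
  refine exists_congr fun k => exists_congr fun j => ?_
  rw [P.lt_width_iff, FareyCycle.pslCorner, P.cycle_corner, zpow_natCast, inv_eq_iff_eq_inv,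
    ← QuotientGroup.mk_inv, mul_inv_rev]
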